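/- Let $k$ be a field of characteristic different from $2$, let $G$ be a nonabelian torsion-free nilpotent group, and let $D$ be the division ring of fractions of the group algebra $k[G]$; that is, $D$ is a division $k$-algebra containing $k[G]$ as a $k$-subalgebra, and every element of $D$ has the form $as^{-1}$ with $a,s\in k[G]$, $s\neq 0$. Let $\ast$ be an involution on $G$, that is, a map $G\to G$ with $(gh)^{\ast}=h^{\ast}g^{\ast}$ and $(g^{\ast})^{\ast}=g$ for all $g,h\in G$, and let $\ast$ also denote a $k$-involution on $D$ induced by it, that is, a $k$-linear map $D\to D$ with $(xy)^{\ast}=y^{\ast}x^{\ast}$ and $(x^{\ast})^{\ast}=x$ for all $x,y\in D$ which extends the involution of $G\subseteq k[G]\subseteq D$. Then: (1) $D$ contains a free symmetric pair: there are nonzero $u,v\in D$ with $u^{\ast}=u$ and $v^{\ast}=v$ such that the subgroup of $D\setminus\{0\}$ generated by $u$ and $v$ is free and noncyclic; (2) $D$ contains a free unitary pair: there are nonzero $u,v\in D$ with $uu^{\ast}=u^{\ast}u=1$ and $vv^{\ast}=v^{\ast}v=1$ such that the subgroup of $D\setminus\{0\}$ generated by $u$ and $v$ is free and noncyclic. 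-/

import Mathlib

/-- The division ring `D` is, through the ring homomorphism `f`, a division ring of (right)
fractions of the ring `R`: `f` is injective and every element of `D` has the form
`f a * (f s)⁻¹` with `a, s ∈ R` and `s ≠ 0`. -/
structure IsDivisionRingOfFractions {R D : Type*} [Ring R] [DivisionRing D] (f : R →+* D) :
    Prop where
  injective : Function.Injective f
  exists_fraction : ∀ d : D, ∃ a s : R, s ≠ 0 ∧ d = f a * (f s)⁻¹

/-- The units `u` and `v` generate a free noncyclic subgroup of the group of units. -/
def IsFreePair {R : Type*} [Monoid R] (u v : Rˣ) : Prop :=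
  IsFreeGroup (Subgroup.closure ({u, v} : Set Rˣ)) ∧
    ¬ IsCyclic (Subgroup.closure ({u, v} : Set Rˣ))

/-- A free symmetric pair: both elements are fixed by the involution, and they generate a free
noncyclic subgroup of the group of units. -/
def IsFreeSymmetricPair {R : Type*} [Monoid R] [StarMul R] (u v : Rˣ) : Prop :=
  IsSelfAdjoint (u : R) ∧ IsSelfAdjoint (v : R) ∧ IsFreePair u v

/-- A free unitary pair: both elements satisfy `x * star x = star x * x = 1`, and they generate a
free noncyclic subgroup of the group of units. -/
def IsFreeUnitaryPair {R : Type*} [Monoid R] [StarMul R] (u v : Rˣ) : Prop :=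
  (u : R) ∈ unitary R ∧ (v : R) ∈ unitary R ∧ IsFreePair u v

/-! Torsion-freeness and nilpotency give `a`, `b` in `G` whose commutator `c` is central of infinite
order, each of `a`, `b` being fixed or inverted by the involution (`exists_heisenberg_pair`). The
monomials `c ^ l * b ^ n * a ^ m` are linearly independent, so the Heisenberg algebra embeds in `D`,
and it suffices to find the pairs among fractions of its elements.

Freeness is tested on matrices. Let `ω` be a primitive `n`-th root of unity, with `n` even and
tending to infinity, and send `c` to `ω`, `a` to `α X` times the clock matrix and `b` to `β X ^ n`
times the shift matrix, over `K[X]`. The lowest-order term at `X = 0` shows that a fixed nonzero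
element eventually has nonzero determinant (`eventually_det_ne_zero`), so denominators do no harm.
At `X = 1` the eigenvalues of `a` are `α ω ^ j`. If `F` has `α` as its only root among them, then `F
(-X)` vanishes only at `j = n / 2`, and after clearing denominators `F (a) * F (-a)⁻¹` and its
inverse become rank-one matrices supported on the eigenvectors `n / 2` and `0`. The same holds for
`b`, whose eigenbasis is the Fourier basis. No entry of the Fourier matrix or of its inverse
vanishes, so a nonempty reduced word in these matrices is a nonzero rank-one matrix and never
scalar, whereas a word equal to `1` in `D` would specialize to a scalar matrix
(`injective_lift_of_specialization`).

It remains to choose `F` so that the fractions are symmetric or unitary. The square of the Cayley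
fraction `(1 + g) * (1 - g)⁻¹` is symmetric whether `g` is fixed or inverted. For unitary elements,
when `a` and `b` are both fixed, `c` is inverted and the Cayley transforms of the skew elements `(c
- c⁻¹) * g` serve. When both are inverted, a quadratic `F` with roots `t` and `-1 / t` serves. In
the mixed case `a` gets the quadratic letter, and `b` is replaced by the skew element `(a ^ 2 - c) *
a⁻¹ * b`, which still satisfies the Heisenberg relation with `a` and `c`. -/

open scoped commutatorElement

/-! ### Noncommuting pairs adapted to the involution -/

section CommutatorPairs

variable {G : Type*} [Group G]

theorem commutatorElement_mul_right_of_central {a x y : G}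
    (hy : ⁅a, y⁆ ∈ Subgroup.center G) : ⁅a, x * y⁆ = ⁅a, x⁆ * ⁅a, y⁆ := by
  have h := Subgroup.mem_center_iff.1 hy x
  calc ⁅a, x * y⁆ = a * x * a⁻¹ * (⁅a, y⁆ * x⁻¹) := by
        simp only [commutatorElement_def]; group
    _ = a * x * a⁻¹ * (x⁻¹ * (x * ⁅a, y⁆) * x⁻¹) := by group
    _ = a * x * a⁻¹ * (x⁻¹ * (⁅a, y⁆ * x) * x⁻¹) := by rw [h]
    _ = ⁅a, x⁆ * ⁅a, y⁆ := by simp only [commutatorElement_def]; group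

theorem commutatorElement_mul_left_of_central {a a' x : G}
    (ha : ⁅a', x⁆ ∈ Subgroup.center G) : ⁅a * a', x⁆ = ⁅a', x⁆ * ⁅a, x⁆ := by
  have h := Subgroup.mem_center_iff.1 ha a
  calc ⁅a * a', x⁆ = (a * ⁅a', x⁆) * (x * a⁻¹ * x⁻¹) := by
        simp only [commutatorElement_def]; group
    _ = (⁅a', x⁆ * a) * (x * a⁻¹ * x⁻¹) := by rw [h]
    _ = ⁅a', x⁆ * ⁅a, x⁆ := by simp only [commutatorElement_def]; group

theorem mul_self_ne_one_of_torsionFree (htf : ∀ g : G, g ≠ 1 → ¬ IsOfFinOrder g) {g : G}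
    (hg : g ≠ 1) : g * g ≠ 1 := fun h =>
  htf g hg (isOfFinOrder_iff_pow_eq_one.2 ⟨2, by norm_num, by rw [pow_two, h]⟩)

theorem mem_upperCentralSeries_two {a : G} :
    a ∈ Subgroup.upperCentralSeries G 2 ↔ ∀ x, ⁅a, x⁆ ∈ Subgroup.center G := by
  rw [Subgroup.mem_upperCentralSeries_succ_iff, Subgroup.upperCentralSeries_one]

/-- If the second centre equalled the first, the upper central series would be stationary from there
on and `G` would be abelian. -/
theorem exists_mem_upperCentralSeries_two_commutator_ne_one [Group.IsNilpotent G]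
    (hna : ∃ a b : G, a * b ≠ b * a) :
    ∃ a ∈ Subgroup.upperCentralSeries G 2, ∃ b : G, ⁅a, b⁆ ≠ 1 := by
  by_contra! hcon
  have h12 : Subgroup.upperCentralSeries G 2 ≤ Subgroup.upperCentralSeries G 1 := by
    intro a ha
    rw [Subgroup.upperCentralSeries_one, Subgroup.mem_center_iff]
    exact fun g => (commutatorElement_eq_one_iff_mul_comm.1 (hcon a ha g)).symm
  have hall : ∀ n, Subgroup.upperCentralSeries G n ≤ Subgroup.upperCentralSeries G 1 := by
    intro n
    induction n with
    | zero => simp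
    | succ n ih =>
      intro x hx
      refine h12 ?_
      rw [Subgroup.mem_upperCentralSeries_succ_iff] at hx ⊢
      exact fun y => ih (hx y)
  obtain ⟨n, hn⟩ := Group.IsNilpotent.nilpotent G
  obtain ⟨a, b, hab⟩ := hna
  have ha := hall n (hn ▸ Subgroup.mem_top a)
  rw [Subgroup.upperCentralSeries_one, Subgroup.mem_center_iff] at ha
  exact hab (ha b).symm

variable [StarMul G]

/-- If `⁅a, star w⁆` always equals `⁅a, w⁆⁻¹` then some `b` noncommuting with `a` is
inverted by `star`. -/
theorem exists_star_eq_inv_of_mem_upperCentralSeries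
    (htf : ∀ g : G, g ≠ 1 → ¬ IsOfFinOrder g) {a : G}
    (ha : a ∈ Subgroup.upperCentralSeries G 2) (hinv : ∀ w : G, ⁅a, (star w)⁻¹⁆ = ⁅a, w⁆) (n : ℕ) :
    ∀ w : G, ⁅a, w⁆ ≠ 1 → w⁻¹ * (star w)⁻¹ ∈ Subgroup.upperCentralSeries G n →
      ∃ b : G, ⁅a, b⁆ ≠ 1 ∧ star b = b⁻¹ := by
  rw [mem_upperCentralSeries_two] at ha
  induction n with
  | zero =>
    intro w hw h
    rw [Subgroup.upperCentralSeries_zero, Subgroup.mem_bot] at h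
    refine ⟨w, hw, ?_⟩
    have h' : star w * w = 1 := by simpa using congrArg (·⁻¹) h
    exact eq_inv_of_mul_eq_one_left h'
  | succ n ih =>
    intro w hw h
    -- With the automorphism `σ w = (star w)⁻¹`, replace `w` by `w * σ w`. This squares the
    -- commutator with `a`, and since `σ` swaps the two factors, the new defect is a commutator of
    -- the inverse of the old one, hence one step lower in the central series.
    refine ih (w * (star w)⁻¹) ?_ ?_
    · rw [commutatorElement_mul_right_of_central (ha _), hinv]
      exact mul_self_ne_one_of_torsionFree htf hw
    · have h2 := Subgroup.mem_upperCentralSeries_succ_iff.1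
        ((Subgroup.upperCentralSeries G (n + 1)).inv_mem h) w⁻¹
      have : (w * (star w)⁻¹)⁻¹ * (star (w * (star w)⁻¹))⁻¹ = ⁅(w⁻¹ * (star w)⁻¹)⁻¹, w⁻¹⁆ := by
        simp only [star_mul, star_inv, star_star, commutatorElement_def]; group
      rwa [this]

/-- The automorphism `g ↦ (star g)⁻¹` of a group with involution. -/
def starInvMulEquiv (G : Type*) [Group G] [StarMul G] : G ≃* G where
  toFun g := (star g)⁻¹
  invFun g := (star g)⁻¹
  left_inv g := by simp
  right_inv g := by simp
  map_mul' g h := by simp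

theorem star_mem_upperCentralSeries {a : G} {n : ℕ} (ha : a ∈ Subgroup.upperCentralSeries G n) :
    star a ∈ Subgroup.upperCentralSeries G n := by
  have h : (Subgroup.upperCentralSeries G n).Characteristic := inferInstance
  have h1 : a ∈ (Subgroup.upperCentralSeries G n).comap (starInvMulEquiv G).toMonoidHom := by
    rwa [h.fixed]
  exact (Subgroup.inv_mem_iff _).1 h1

/-- The norm `a * star a` is fixed. If it is central, then `a` and `star a` commute, so `a * (star
a)⁻¹` is inverted. It equals `a * a` modulo the centre, so it is noncentral because a nontrivial
commutator has nontrivial square. -/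
theorem exists_noncentral_star_eq (htf : ∀ g : G, g ≠ 1 → ¬ IsOfFinOrder g)
    [Group.IsNilpotent G] (hna : ∃ a b : G, a * b ≠ b * a) :
    ∃ a ∈ Subgroup.upperCentralSeries G 2, (∃ b : G, ⁅a, b⁆ ≠ 1) ∧
      (star a = a ∨ star a = a⁻¹) := by
  obtain ⟨a, ha, b, hab⟩ := exists_mem_upperCentralSeries_two_commutator_ne_one hna
  have hs := star_mem_upperCentralSeries ha
  by_cases hc : ∃ b : G, ⁅a * star a, b⁆ ≠ 1
  · exact ⟨a * star a, mul_mem ha hs, hc, Or.inl (by simp)⟩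
  · push Not at hc
    have hcomm : ∀ x, a * star a * x = x * (a * star a) := fun x =>
      commutatorElement_eq_one_iff_mul_comm.1 (hc x)
    refine ⟨a * (star a)⁻¹, mul_mem ha (inv_mem hs), ⟨b, ?_⟩, Or.inr ?_⟩
    · have h1 : ⁅a * (star a)⁻¹, b⁆ = ⁅a * a, b⁆ := by
        have h2 : a * a = (a * star a) * (a * (star a)⁻¹) := by
          rw [← mul_assoc, hcomm a]; group
        have h3 := hcomm (a * (star a)⁻¹ * b * (a * (star a)⁻¹)⁻¹)
        calc ⁅a * (star a)⁻¹, b⁆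
            = (a * (star a)⁻¹ * b * (a * (star a)⁻¹)⁻¹) * (a * star a) * (a * star a)⁻¹ * b⁻¹ := by
              simp only [commutatorElement_def]; group
          _ = ⁅a * a, b⁆ := by
              rw [← h3, h2]; simp only [commutatorElement_def]; group
      rw [h1, commutatorElement_mul_left_of_central (mem_upperCentralSeries_two.1 ha b)]
      exact mul_self_ne_one_of_torsionFree htf hab
    · have h1 := hcomm a⁻¹
      have h2 : a * star a = star a * a := by
        calc a * star a = a * star a * a⁻¹ * a := by group
          _ = star a * a := by rw [h1]; group
      rw [star_mul, star_inv, star_star, mul_inv_rev, inv_inv]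
      calc a⁻¹ * star a = a⁻¹ * (star a * a) * a⁻¹ := by group
        _ = star a * a⁻¹ := by rw [← h2]; group

/-- A nonabelian torsion-free nilpotent group with involution contains a noncommuting pair with
central commutator, each of whose members is fixed or inverted by the involution. -/
theorem exists_heisenberg_pair (htf : ∀ g : G, g ≠ 1 → ¬ IsOfFinOrder g)
    [Group.IsNilpotent G] (hna : ∃ a b : G, a * b ≠ b * a) :
    ∃ a b c : G, a * b = c * b * a ∧ (∀ g, c * g = g * c) ∧ c ≠ 1 ∧
      (star a = a ∨ star a = a⁻¹) ∧ (star b = b ∨ star b = b⁻¹) := by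
  obtain ⟨a, ha, ⟨b, hab⟩, hsa⟩ := exists_noncentral_star_eq htf hna
  have hc := mem_upperCentralSeries_two.1 ha
  suffices h : ∃ b : G, ⁅a, b⁆ ≠ 1 ∧ (star b = b ∨ star b = b⁻¹) by
    obtain ⟨b, hb, hsb⟩ := h
    exact ⟨a, b, ⁅a, b⁆, by simp [commutatorElement_def],
      fun g => (Subgroup.mem_center_iff.1 (hc b) g).symm, hb, hsa, hsb⟩
  by_cases h : ∃ b : G, ⁅a, b * star b⁆ ≠ 1
  · obtain ⟨b, hb⟩ := h
    -- Either some norm fails to commute with `a`, or all norms commute with it, which is the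
    -- hypothesis of the descent along the upper central series.
    exact ⟨b * star b, hb, Or.inl (by simp)⟩
  · push Not at h
    have hinv : ∀ w : G, ⁅a, (star w)⁻¹⁆ = ⁅a, w⁆ := by
      intro w
      have h1 : ⁅a, w * star w * (star w)⁻¹⁆ = ⁅a, (star w)⁻¹⁆ := by
        rw [commutatorElement_mul_right_of_central (hc _), h, one_mul]
      rwa [mul_inv_cancel_right, eq_comm] at h1
    obtain ⟨n, hn⟩ := Group.IsNilpotent.nilpotent G
    obtain ⟨b, hb, hsb⟩ := exists_star_eq_inv_of_mem_upperCentralSeries htf ha hinv n b hab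
      (hn ▸ Subgroup.mem_top _)
    exact ⟨b, hb, Or.inr hsb⟩

end CommutatorPairs

/-! ### The Heisenberg monoid algebra and its Ore condition -/

section CommonMultiple

variable {k M : Type*} [Field k] [Monoid M]

open scoped Pointwise in
/-- Two elements of a monoid algebra have a nontrivial common right multiple as soon as left
multiplication by their supports does not double the size of some finite set. -/
theorem MonoidAlgebra.exists_mul_eq_mul_of_card_lt [DecidableEq M] (r s : MonoidAlgebra k M)
    (W W' : Finset M) (hr : r.coeff.support * W ⊆ W') (hs : s.coeff.support * W ⊆ W')
    (hcard : W'.card < 2 * W.card) :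
    ∃ x y : MonoidAlgebra k M, (x ≠ 0 ∨ y ≠ 0) ∧ r * x = s * y := by
  classical
  let T : (W → k) →ₗ[k] MonoidAlgebra k M :=
    ∑ w : W, (MonoidAlgebra.lsingle (R := k) (w : M)) ∘ₗ LinearMap.proj w
  have hT : ∀ x (w : W), (T x).coeff w = x w := by
    intro x w
    simp [T, LinearMap.sum_apply, Finsupp.single_apply, Finset.sum_apply']
  have hTs : ∀ x, (T x).coeff.support ⊆ W := by
    intro x m hm
    by_contra hmW
    refine (Finsupp.mem_support_iff.1 hm) ?_
    simp only [T, LinearMap.sum_apply, LinearMap.comp_apply, MonoidAlgebra.coeff_sum,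
      Finset.sum_apply', LinearMap.proj_apply, MonoidAlgebra.lsingle_apply,
      MonoidAlgebra.coeff_single]
    refine Finset.sum_eq_zero fun w _ => Finsupp.single_eq_of_ne ?_
    rintro rfl
    exact hmW w.2
  let c : MonoidAlgebra k M →ₗ[k] (W' → k) :=
    LinearMap.pi fun w => Finsupp.lapply (w : M) ∘ₗ (MonoidAlgebra.coeffLinearEquiv k).toLinearMap
  -- The map `(x, y) ↦ r * x - s * y` on elements supported in `W`, read off on `W'`. It has a
  -- kernel because its source has dimension `2 * W.card`.
  let Φ : (W → k) × (W → k) →ₗ[k] (W' → k) :=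
    c ∘ₗ (LinearMap.coprod (LinearMap.mulLeft k r ∘ₗ T) (-(LinearMap.mulLeft k s ∘ₗ T)))
  have hker : LinearMap.ker Φ ≠ ⊥ := by
    apply LinearMap.ker_ne_bot_of_finrank_lt
    simp only [Module.finrank_prod, Module.finrank_fintype_fun_eq_card, Fintype.card_coe]
    omega
  obtain ⟨⟨x, y⟩, hxy, hne⟩ := (Submodule.ne_bot_iff _).1 hker
  refine ⟨T x, T y, ?_, ?_⟩
  · by_contra! h
    refine hne (Prod.ext (funext fun w => ?_) (funext fun w => ?_))
    · exact (hT x w).symm.trans (by rw [h.1]; rfl)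
    · exact (hT y w).symm.trans (by rw [h.2]; rfl)
  · rw [← sub_eq_zero]
    ext m
    by_cases hm : m ∈ W'
    · have := congrFun (LinearMap.mem_ker.1 hxy) ⟨m, hm⟩
      simpa [Φ, c, sub_eq_add_neg] using this
    · have h1 : ∀ (q : MonoidAlgebra k M) (z : W → k), q.coeff.support * W ⊆ W' →
          (q * T z).coeff m = 0 := by
        intro q z hq
        rw [← Finsupp.notMem_support_iff]
        exact fun h => hm (hq (Finset.mul_subset_mul_left (hTs z)
          (MonoidAlgebra.support_coeff_mul_subset _ _ h)))
      simp [h1 r x hr, h1 s y hs]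

end CommonMultiple

/-- The monoid of monomials `c ^ l * b ^ n * a ^ m` subject to `a * b = c * b * a` with `c`
central. -/
@[ext]
structure HeisenbergMonoid where
  /-- the exponent of the central generator -/
  c : ℕ
  /-- the exponent of `b` -/
  b : ℕ
  /-- the exponent of `a` -/
  a : ℕ

namespace HeisenbergMonoid

instance : Monoid HeisenbergMonoid where
  mul x y := ⟨x.c + y.c + x.a * y.b, x.b + y.b, x.a + y.a⟩
  one := ⟨0, 0, 0⟩
  mul_assoc x y z := by
    apply HeisenbergMonoid.ext
    · change (x.c + y.c + x.a * y.b) + z.c + (x.a + y.a) * z.b =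
        x.c + (y.c + z.c + y.a * z.b) + x.a * (y.b + z.b)
      ring
    · exact add_assoc _ _ _
    · exact add_assoc _ _ _
  one_mul x := by
    apply HeisenbergMonoid.ext
    · change 0 + x.c + 0 * x.b = x.c
      ring
    · exact zero_add _
    · exact zero_add _
  mul_one x := by
    apply HeisenbergMonoid.ext
    · change x.c + 0 + x.a * 0 = x.c
      ring
    · exact add_zero _
    · exact add_zero _

theorem mul_def (x y : HeisenbergMonoid) :
    x * y = ⟨x.c + y.c + x.a * y.b, x.b + y.b, x.a + y.a⟩ := rfl

theorem one_def : (1 : HeisenbergMonoid) = ⟨0, 0, 0⟩ := rfl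

theorem pow_mul_pow_of_mul_eq {M : Type*} [Monoid M] {A B C : M} (hAB : A * B = C * B * A)
    (hCA : Commute C A) (hCB : Commute C B) (m n : ℕ) :
    A ^ m * B ^ n = C ^ (m * n) * B ^ n * A ^ m := by
  have h1 : ∀ n, A * B ^ n = C ^ n * B ^ n * A := by
    intro n
    induction n with
    | zero => simp
    | succ n ih =>
      calc A * B ^ (n + 1) = A * B ^ n * B := by rw [pow_succ, mul_assoc]
        _ = C ^ n * B ^ n * (A * B) := by rw [ih, mul_assoc]
        _ = C ^ n * (B ^ n * C) * B * A := by rw [hAB]; simp only [mul_assoc]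
        _ = C ^ (n + 1) * B ^ (n + 1) * A := by
          rw [← (hCB.pow_right n).eq]; simp only [pow_succ, mul_assoc]
  induction m with
  | zero => simp
  | succ m ih =>
    calc A ^ (m + 1) * B ^ n = A * (A ^ m * B ^ n) := by rw [pow_succ', mul_assoc]
      _ = (A * C ^ (m * n)) * B ^ n * A ^ m := by rw [ih]; simp only [mul_assoc]
      _ = C ^ (m * n) * (A * B ^ n) * A ^ m := by
        rw [← (hCA.pow_left _).eq]; simp only [mul_assoc]
      _ = C ^ ((m + 1) * n) * B ^ n * A ^ (m + 1) := by
        rw [h1, add_mul, one_mul, pow_add, pow_succ']; simp only [mul_assoc]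

/-- The homomorphism out of the Heisenberg monoid given by elements subject to its relations. -/
def lift {M : Type*} [Monoid M] (A B C : M) (hAB : A * B = C * B * A)
    (hCA : Commute C A) (hCB : Commute C B) : HeisenbergMonoid →* M where
  toFun x := C ^ x.c * B ^ x.b * A ^ x.a
  map_one' := by simp [one_def]
  map_mul' x y := by
    have hAC := (hCA.pow_pow y.c x.a).symm
    have hBC := (hCB.pow_pow y.c x.b).symm
    have hBC' := (hCB.pow_pow (x.a * y.b) x.b).symm
    simp only [mul_def]
    symm
    calc C ^ x.c * B ^ x.b * A ^ x.a * (C ^ y.c * B ^ y.b * A ^ y.a)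
        = C ^ x.c * B ^ x.b * (A ^ x.a * C ^ y.c) * B ^ y.b * A ^ y.a := by
          simp only [mul_assoc]
      _ = C ^ x.c * (B ^ x.b * C ^ y.c) * (A ^ x.a * B ^ y.b) * A ^ y.a := by
          rw [hAC.eq]; simp only [mul_assoc]
      _ = C ^ x.c * C ^ y.c * (B ^ x.b * C ^ (x.a * y.b)) * B ^ y.b * A ^ x.a * A ^ y.a := by
          rw [hBC.eq, pow_mul_pow_of_mul_eq hAB hCA hCB]; simp only [mul_assoc]
      _ = _ := by
          rw [hBC'.eq]; simp only [pow_add, mul_assoc]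

theorem lift_apply {M : Type*} [Monoid M] (A B C : M) (hAB : A * B = C * B * A)
    (hCA : Commute C A) (hCB : Commute C B) (x : HeisenbergMonoid) :
    lift A B C hAB hCA hCB x = C ^ x.c * B ^ x.b * A ^ x.a := rfl

theorem eq_pow_mul_pow_mul_pow (x : HeisenbergMonoid) :
    x = ⟨1, 0, 0⟩ ^ x.c * ⟨0, 1, 0⟩ ^ x.b * ⟨0, 0, 1⟩ ^ x.a := by
  have hc : ∀ n, (⟨1, 0, 0⟩ : HeisenbergMonoid) ^ n = ⟨n, 0, 0⟩ := fun n => by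
    induction n with
    | zero => rfl
    | succ n ih => rw [pow_succ, ih]; rfl
  have hb : ∀ n, (⟨0, 1, 0⟩ : HeisenbergMonoid) ^ n = ⟨0, n, 0⟩ := fun n => by
    induction n with
    | zero => rfl
    | succ n ih => rw [pow_succ, ih]; simp [mul_def]
  have ha : ∀ n, (⟨0, 0, 1⟩ : HeisenbergMonoid) ^ n = ⟨0, 0, n⟩ := fun n => by
    induction n with
    | zero => rfl
    | succ n ih => rw [pow_succ, ih]; simp [mul_def]
  rw [hc, hb, ha]
  simp [mul_def]

/-- The monomials with bounded exponents. -/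
def box (L N : ℕ) : Finset HeisenbergMonoid :=
  (Finset.range L ×ˢ Finset.range N ×ˢ Finset.range N).map
    ⟨fun p => ⟨p.1, p.2.1, p.2.2⟩, fun p q h => by
      obtain ⟨h1, h2, h3⟩ := HeisenbergMonoid.mk.inj h
      exact Prod.ext h1 (Prod.ext h2 h3)⟩

theorem mem_box {L N : ℕ} {x : HeisenbergMonoid} :
    x ∈ box L N ↔ x.c < L ∧ x.b < N ∧ x.a < N := by
  simp only [box, Finset.mem_map, Finset.mem_product, Finset.mem_range]
  constructor
  · rintro ⟨p, hp, rfl⟩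
    exact hp
  · intro h
    exact ⟨(x.c, x.b, x.a), h, rfl⟩

theorem card_box (L N : ℕ) : (box L N).card = L * (N * N) := by
  simp [box]

end HeisenbergMonoid

/-- The algebra with generators `a`, `b`, `c` and relations `a * b = c * b * a`, `c` central. -/
abbrev HeisenbergAlgebra (k : Type*) [Field k] := MonoidAlgebra k HeisenbergMonoid

namespace HeisenbergAlgebra

open HeisenbergMonoid

variable {k : Type*} [Field k]

open scoped Pointwise in
/-- The Heisenberg algebra satisfies the right Ore condition. -/
theorem exists_mul_eq_mul (r s : HeisenbergAlgebra k) :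
    ∃ x y : HeisenbergAlgebra k, (x ≠ 0 ∨ y ≠ 0) ∧ r * x = s * y := by
  classical
  obtain ⟨d, hd0, hd⟩ : ∃ d, 0 < d ∧ ∀ x ∈ r.coeff.support ∪ s.coeff.support,
      x.c ≤ d ∧ x.b ≤ d ∧ x.a ≤ d := by
    refine ⟨(r.coeff.support ∪ s.coeff.support).sup (fun x => x.c + x.b + x.a) + 1,
      Nat.succ_pos _, fun x hx => ?_⟩
    have := Finset.le_sup (f := fun x : HeisenbergMonoid => x.c + x.b + x.a) hx
    omega
  -- Moving `a ^ d` past `b ^ (10 * d)` costs `c ^ (10 * d ^ 2)`, so the box must be quadratically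
  -- longer in the direction of `c`. With these constants the box grows by a factor of at most `1.11
  -- * 1.21 < 2`.
  have hsub : ∀ q : HeisenbergAlgebra k, q.coeff.support ⊆ r.coeff.support ∪ s.coeff.support →
      q.coeff.support * box (100 * d ^ 2) (10 * d) ⊆ box (110 * d ^ 2 + d) (11 * d) := by
    intro q hq z hz
    obtain ⟨x, hx, y, hy, rfl⟩ := Finset.mem_mul.1 hz
    obtain ⟨h1, h2, h3⟩ := hd x (hq hx)
    obtain ⟨h4, h5, h6⟩ := mem_box.1 hy
    rw [mem_box, mul_def]
    refine ⟨?_, by simp only; omega, by simp only; omega⟩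
    have : x.a * y.b ≤ d * (10 * d) := Nat.mul_le_mul h3 h5.le
    simp only
    nlinarith
  refine MonoidAlgebra.exists_mul_eq_mul_of_card_lt r s _ _
    (hsub r Finset.subset_union_left) (hsub s Finset.subset_union_right) ?_
  rw [card_box, card_box]
  have h1 : d ≤ d ^ 2 := Nat.le_self_pow (by norm_num) d
  have h2 : 0 < d ^ 2 := by positivity
  calc (110 * d ^ 2 + d) * (11 * d * (11 * d)) ≤ (111 * d ^ 2) * (11 * d * (11 * d)) := by
        gcongr; omega
    _ = 13431 * (d ^ 2 * d ^ 2) := by ring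
    _ < 20000 * (d ^ 2 * d ^ 2) := by
        have : 0 < d ^ 2 * d ^ 2 := by positivity
        omega
    _ = 2 * (100 * d ^ 2 * (10 * d * (10 * d))) := by ring

/-- The algebra homomorphism given by elements subject to the relations of the generators. -/
noncomputable def lift {E : Type*} [Ring E] [Algebra k E] (A B C : E) (hAB : A * B = C * B * A)
    (hCA : Commute C A) (hCB : Commute C B) : HeisenbergAlgebra k →ₐ[k] E :=
  MonoidAlgebra.lift k E HeisenbergMonoid (HeisenbergMonoid.lift A B C hAB hCA hCB)

variable (k) in
/-- The generator `a`. -/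
noncomputable def genA : HeisenbergAlgebra k := MonoidAlgebra.of k HeisenbergMonoid ⟨0, 0, 1⟩

variable (k) in
/-- The generator `b`. -/
noncomputable def genB : HeisenbergAlgebra k := MonoidAlgebra.of k HeisenbergMonoid ⟨0, 1, 0⟩

variable (k) in
/-- The central generator. -/
noncomputable def genC : HeisenbergAlgebra k := MonoidAlgebra.of k HeisenbergMonoid ⟨1, 0, 0⟩

theorem genA_mul_genB : genA k * genB k = genC k * genB k * genA k := by
  simp only [genA, genB, genC, ← map_mul, mul_def]

theorem commute_genC_genA : Commute (genC k) (genA k) := by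
  simp only [genA, genC, Commute, SemiconjBy, ← map_mul, mul_def]

theorem commute_genC_genB : Commute (genC k) (genB k) := by
  simp only [genB, genC, Commute, SemiconjBy, ← map_mul, mul_def]

section Lift

variable {E : Type*} [Ring E] [Algebra k E] (A B C : E) (hAB : A * B = C * B * A)
    (hCA : Commute C A) (hCB : Commute C B)

@[simp]
theorem lift_genA : lift A B C hAB hCA hCB (genA k) = A := by
  simp [lift, genA, HeisenbergMonoid.lift_apply]

@[simp]
theorem lift_genB : lift A B C hAB hCA hCB (genB k) = B := by
  simp [lift, genB, HeisenbergMonoid.lift_apply]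

@[simp]
theorem lift_genC : lift A B C hAB hCA hCB (genC k) = C := by
  simp [lift, genC, HeisenbergMonoid.lift_apply]

theorem algHom_apply (f : HeisenbergAlgebra k →ₐ[k] E) (r : HeisenbergAlgebra k) :
    f r = ∑ x ∈ r.coeff.support,
      r.coeff x • (f (genC k) ^ x.c * f (genB k) ^ x.b * f (genA k) ^ x.a) := by
  have hf : f = lift (f (genA k)) (f (genB k)) (f (genC k))
      (by rw [← map_mul, genA_mul_genB, map_mul, map_mul])
      (commute_genC_genA.map f) (commute_genC_genB.map f) := by
    refine MonoidAlgebra.algHom_ext (fun x : HeisenbergMonoid => ?_) (Subsingleton.elim _ _)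
    have hx : (MonoidAlgebra.single x 1 : HeisenbergAlgebra k) =
        genC k ^ x.c * genB k ^ x.b * genA k ^ x.a := by
      conv_lhs => rw [eq_pow_mul_pow_mul_pow x]
      simp only [genA, genB, genC, ← map_pow, ← map_mul]
      rfl
    rw [hx]
    simp
  conv_lhs => rw [hf]
  rw [lift, MonoidAlgebra.lift_apply]
  rfl

end Lift

end HeisenbergAlgebra

/-! ### Nonvanishing determinants from lowest-order terms -/

open Polynomial Filter

/-- A polynomial has finitely many roots, and each has one fixed order, which `ω i` eventually
exceeds. -/
theorem Polynomial.eventually_eval_ne_zero_of_tendsto_orderOf {I K : Type*} [Field K]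
    {l : Filter I} {ω : I → K} (hω : Tendsto (fun i => orderOf (ω i)) l atTop) {p : K[X]}
    (hp : p ≠ 0) : ∀ᶠ i in l, p.eval (ω i) ≠ 0 := by
  classical
  have h : ∀ᶠ i in l, ∀ z ∈ p.roots.toFinset, ω i ≠ z := by
    rw [Filter.eventually_all_finset]
    intro z _
    filter_upwards [hω.eventually_gt_atTop (orderOf z)] with i hi h
    rw [h] at hi
    exact lt_irrefl _ hi
  filter_upwards [h] with i hi h0
  exact hi (ω i) (by simpa [hp] using h0) rfl

namespace HeisenbergAlgebra

variable {k K : Type*} [Field k] [Field K] [Algebra k K]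

/-- Give `a` weight `1` and `b` weight `N`. As the exponents of `a` stay below `N`, the weight
determines the exponents of both `b` and `a`. The coefficient of the lowest power of `X` is
therefore a single product `B ^ b * A ^ a` at `X = 0`, times a value of a polynomial in `ω`, and is
invertible. -/
theorem det_ne_zero_of_lowest_term {m : Type*} [Fintype m] [DecidableEq m]
    (f : HeisenbergAlgebra k →ₐ[k] Matrix m m K[X]) {ω : K} {N : ℕ} {A B : Matrix m m K[X]}
    (hc : f (genC k) = algebraMap K _ ω) (ha : f (genA k) = (X : K[X]) • A)
    (hb : f (genB k) = (X ^ N : K[X]) • B)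
    (hA : A.det.eval 0 ≠ 0) (hB : B.det.eval 0 ≠ 0) {r : HeisenbergAlgebra k} (hr : r ≠ 0)
    (hN : ∀ x ∈ r.coeff.support, x.a < N)
    (hω : ∀ x ∈ r.coeff.support, ∑ y ∈ r.coeff.support with y.b = x.b ∧ y.a = x.a,
      algebraMap k K (r.coeff y) * ω ^ y.c ≠ 0) : (f r).det ≠ 0 := by
  have hne : r.coeff.support.Nonempty := by
    rw [Finsupp.support_nonempty_iff]
    simpa using hr
  obtain ⟨x, hx, hmin⟩ := Finset.exists_min_image r.coeff.support (fun y => N * y.b + y.a) hne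
  have hinj : ∀ y ∈ r.coeff.support, N * y.b + y.a = N * x.b + x.a → y.b = x.b ∧ y.a = x.a := by
    intro y hy h
    have hNpos : 0 < N := lt_of_le_of_lt (Nat.zero_le _) (hN x hx)
    have h1 : y.b = x.b := by
      have := congrArg (· / N) h
      simpa [Nat.mul_add_div hNpos, Nat.div_eq_of_lt (hN x hx), Nat.div_eq_of_lt (hN y hy)]
        using this
    refine ⟨h1, ?_⟩
    rw [h1] at h
    omega
  let M : Matrix m m K[X] := ∑ y ∈ r.coeff.support,
    (C (algebraMap k K (r.coeff y) * ω ^ y.c) * X ^ (N * y.b + y.a - (N * x.b + x.a))) •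
      (B ^ y.b * A ^ y.a)
  have hfr : f r = (X ^ (N * x.b + x.a) : K[X]) • M := by
    rw [algHom_apply, Finset.smul_sum]
    refine Finset.sum_congr rfl fun y hy => ?_
    have hle := hmin y hy
    have h1 : (X : K[X]) ^ (N * y.b + y.a) =
        X ^ (N * x.b + x.a) * X ^ (N * y.b + y.a - (N * x.b + x.a)) := by
      rw [← pow_add, Nat.add_sub_cancel' hle]
    have h2 : r.coeff y • (algebraMap K (Matrix m m K[X]) ω ^ y.c * ((X ^ N : K[X]) • B) ^ y.b *
        ((X : K[X]) • A) ^ y.a) = (C (algebraMap k K (r.coeff y) * ω ^ y.c) * X ^ (N * y.b + y.a)) •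
          (B ^ y.b * A ^ y.a) := by
      rw [_root_.smul_pow, _root_.smul_pow, ← map_pow, ← algebraMap_smul K (r.coeff y), ← Algebra.smul_def,
        smul_mul_assoc, smul_mul_assoc, mul_smul_comm, smul_smul, smul_smul, ← pow_mul, ← pow_add,
        ← smul_eq_C_mul, smul_assoc]
    rw [hc, ha, hb, h2, h1, smul_smul]
    congr 1
    ring
  have hM : M.det.eval 0 ≠ 0 := by
    have hA' : ((evalRingHom (0 : K)).mapMatrix A).det ≠ 0 := by
      rwa [← RingHom.map_det]
    have hB' : ((evalRingHom (0 : K)).mapMatrix B).det ≠ 0 := by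
      rwa [← RingHom.map_det]
    have hev : (evalRingHom (0 : K)).mapMatrix M =
        (∑ y ∈ r.coeff.support with y.b = x.b ∧ y.a = x.a,
          algebraMap k K (r.coeff y) * ω ^ y.c) •
        (((evalRingHom (0 : K)).mapMatrix B) ^ x.b * ((evalRingHom (0 : K)).mapMatrix A) ^ x.a) := by
      have hsmul : ∀ (p : K[X]) (Z : Matrix m m K[X]), (evalRingHom (0 : K)).mapMatrix (p • Z) =
          p.eval 0 • (evalRingHom (0 : K)).mapMatrix Z := by
        intro p Z
        ext i j
        simp
      rw [map_sum, Finset.sum_filter, Finset.sum_smul]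
      refine Finset.sum_congr rfl fun y hy => ?_
      rw [hsmul, RingHom.map_mul (evalRingHom (0 : K)).mapMatrix, map_pow _ B, map_pow _ A]
      split_ifs with h
      · simp [h.1, h.2]
      · have hpos : N * y.b + y.a - (N * x.b + x.a) ≠ 0 := by
          intro h0
          exact h (hinj y hy (le_antisymm (Nat.sub_eq_zero_iff_le.1 h0) (hmin y hy)))
        simp [hpos]
    change evalRingHom (0 : K) M.det ≠ 0
    rw [RingHom.map_det, hev, Matrix.det_smul, Matrix.det_mul, Matrix.det_pow, Matrix.det_pow]
    exact mul_ne_zero (pow_ne_zero _ (hω x hx))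
      (mul_ne_zero (pow_ne_zero _ hB') (pow_ne_zero _ hA'))
  rw [hfr, Matrix.det_smul]
  refine mul_ne_zero (pow_ne_zero _ (pow_ne_zero _ X_ne_zero)) ?_
  rintro h
  simp [h] at hM

/-- Both conditions of `det_ne_zero_of_lowest_term` concern a finite support. They hold once the
order of `ω i` exceeds the exponents of `a` and `ω i` avoids the roots of finitely many polynomials.
-/
theorem eventually_det_ne_zero {I : Type*} {l : Filter I} {m : I → Type*} [∀ i, Fintype (m i)]
    [∀ i, DecidableEq (m i)] (f : ∀ i, HeisenbergAlgebra k →ₐ[k] Matrix (m i) (m i) K[X])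
    {ω : I → K} (hω : Tendsto (fun i => orderOf (ω i)) l atTop)
    {A B : ∀ i, Matrix (m i) (m i) K[X]}
    (hc : ∀ i, f i (genC k) = algebraMap K _ (ω i)) (ha : ∀ i, f i (genA k) = (X : K[X]) • A i)
    (hb : ∀ i, f i (genB k) = (X ^ orderOf (ω i) : K[X]) • B i)
    (hA : ∀ i, (A i).det.eval 0 ≠ 0) (hB : ∀ i, (B i).det.eval 0 ≠ 0) {r : HeisenbergAlgebra k}
    (hr : r ≠ 0) : ∀ᶠ i in l, (f i r).det ≠ 0 := by
  have h1 : ∀ᶠ i in l, ∀ x ∈ r.coeff.support, x.a < orderOf (ω i) := by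
    rw [Filter.eventually_all_finset]
    exact fun x _ => hω.eventually_gt_atTop _
  have h2 : ∀ᶠ i in l, ∀ x ∈ r.coeff.support,
      ∑ y ∈ r.coeff.support with y.b = x.b ∧ y.a = x.a,
        algebraMap k K (r.coeff y) * ω i ^ y.c ≠ 0 := by
    rw [Filter.eventually_all_finset]
    intro x hx
    have hp : (∑ y ∈ r.coeff.support with y.b = x.b ∧ y.a = x.a,
        monomial y.c (algebraMap k K (r.coeff y))) ≠ 0 := by
      intro h0
      have h3 := congrArg (fun p => p.coeff x.c) h0
      simp only [finsetSum_coeff, coeff_monomial, coeff_zero] at h3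
      rw [Finset.sum_eq_single x] at h3
      · simp at h3
        exact (Finsupp.mem_support_iff.1 hx) h3
      · intro y hy hyx
        rw [if_neg]
        intro hcc
        obtain ⟨-, h4, h5⟩ := Finset.mem_filter.1 hy
        exact hyx (HeisenbergMonoid.ext hcc h4 h5)
      · simp [Finsupp.mem_support_iff.1 hx]
    filter_upwards [eventually_eval_ne_zero_of_tendsto_orderOf hω hp] with i hi
    simpa [eval_finsetSum] using hi
  filter_upwards [h1, h2] with i hi1 hi2
  exact det_ne_zero_of_lowest_term (f i) (hc i) (ha i) (hb i) (hA i) (hB i) hr hi1 hi2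

end HeisenbergAlgebra

/-! ### Free groups and words in rank-one matrices -/

section FreePair

theorem isFreePair_of_injective_lift {R : Type*} [Monoid R] (f : Bool → Rˣ)
    (hf : Function.Injective (FreeGroup.lift f)) : IsFreePair (f true) (f false) := by
  have hrange : (FreeGroup.lift f).range = Subgroup.closure {f true, f false} := by
    rw [FreeGroup.range_lift_eq_closure]
    congr 1
    ext x
    simp [or_comm]
  have e : FreeGroup Bool ≃* Subgroup.closure {f true, f false} :=
    (MonoidHom.ofInjective hf).trans (MulEquiv.subgroupCongr hrange)
  refine ⟨IsFreeGroup.ofMulEquiv e, fun hcyc => ?_⟩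
  have hcomm : ∀ x y : FreeGroup Bool, x * y = y * x := by
    intro x y
    apply e.injective
    have : IsMulCommutative (Subgroup.closure {f true, f false}) := IsCyclic.isMulCommutative
    rw [map_mul, map_mul]
    exact mul_comm' _ _
  have h := hcomm (FreeGroup.of true) (FreeGroup.of false)
  have h2 := congrArg FreeGroup.toWord h
  simp only [FreeGroup.of, FreeGroup.mul_mk, FreeGroup.toWord_mk] at h2
  revert h2
  decide

end FreePair

section RankOne

variable {m K : Type*} [DecidableEq m] [Field K]

/-- Adjacent rank-one factors contract to the scalar `g x ⬝ᵥ w y`. In a reduced word, adjacent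
letters with the same generator carry the same sign, so only the pairings assumed nonzero occur. -/
theorem exists_prod_eq_vecMulVec [Fintype m] {α : Type*} {V : α × Bool → Matrix m m K}
    {w g : α × Bool → m → K} (hV : ∀ x, V x = Matrix.vecMulVec (w x) (g x)) (hg : ∀ x, g x ≠ 0)
    (hgw : ∀ x y : α × Bool, (x.1 = y.1 → x.2 = y.2) → g x ⬝ᵥ w y ≠ 0)
    (L : List (α × Bool)) (x : α × Bool) (hL : FreeGroup.IsReduced (x :: L)) :
    ∃ h : m → K, h ≠ 0 ∧ ((x :: L).map V).prod = Matrix.vecMulVec (w x) h := by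
  induction L generalizing x with
  | nil => exact ⟨g x, hg x, by simp [hV]⟩
  | cons y L ih =>
    rw [FreeGroup.isReduced_cons_cons] at hL
    obtain ⟨h, h0, hprod⟩ := ih y hL.2
    refine ⟨(g x ⬝ᵥ w y) • h, smul_ne_zero (hgw x y hL.1) h0, ?_⟩
    rw [List.map_cons, List.prod_cons, hprod, hV, Matrix.vecMulVec_mul_vecMulVec]

theorem vecMulVec_ne_smul_one [Nontrivial m] {w h : m → K} (hw : w ≠ 0) (hh : h ≠ 0) (t : K) :
    Matrix.vecMulVec w h ≠ t • (1 : Matrix m m K) := by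
  intro heq
  have hentry : ∀ i j, w i * h j = if i = j then t else 0 := by
    intro i j
    have := congrFun (congrFun heq i) j
    simpa [Matrix.vecMulVec_apply, Matrix.one_apply] using this
  obtain ⟨i, hi⟩ := Function.ne_iff.1 hw
  obtain ⟨j, hj⟩ := Function.ne_iff.1 hh
  simp only [Pi.zero_apply] at hi hj
  have hij : i = j := by
    by_contra hne
    have := hentry i j
    rw [if_neg hne] at this
    exact mul_ne_zero hi hj this
  subst hij
  obtain ⟨i', hi'⟩ := exists_ne i
  have h1 := hentry i i
  have h2 := hentry i' i'
  have h3 := hentry i' i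
  rw [if_pos rfl] at h1 h2
  rw [if_neg hi'] at h3
  have ht : t ≠ 0 := h1 ▸ mul_ne_zero hi hj
  have : w i' ≠ 0 := by
    intro h0
    rw [h0, zero_mul] at h2
    exact ht h2.symm
  exact mul_ne_zero this hj h3

end RankOne

/-! ### Passing from words in the division ring to words in matrices -/

section Specialization

variable {R D A : Type*} [Ring R] [DivisionRing D] [CommRing A] {I : Type*} {l : Filter I}
  {m : I → Type*} [∀ i, Fintype (m i)] [∀ i, DecidableEq (m i)]

/-- If letters `z x` of a division ring of fractions specialize to matrices `U i x` up to the
scalars `σ i x`, so do the words in them. -/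
theorem exists_fraction_specialization (ψ : R →+* D) (hψ : Function.Injective ψ)
    (hore : ∀ r s : R, ∃ x y, (x ≠ 0 ∨ y ≠ 0) ∧ r * x = s * y)
    (π : ∀ i, R →+* Matrix (m i) (m i) A) {X : Type*} (z : X → D) (num den : X → R)
    (hden : ∀ x, den x ≠ 0) (hz : ∀ x, z x * ψ (den x) = ψ (num x))
    (U : ∀ i, X → Matrix (m i) (m i) A) (σ : I → X → A)
    (hU : ∀ x, ∀ᶠ i in l, U i x * π i (den x) = σ i x • π i (num x)) (L : List X) :
    ∃ s p : R, s ≠ 0 ∧ (L.map z).prod * ψ s = ψ p ∧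
      ∀ᶠ i in l, (L.map (U i)).prod * π i s = (L.map (σ i)).prod • π i p := by
  have hdom : ∀ r s : R, r * s = 0 → r = 0 ∨ s = 0 := by
    intro r s h
    have := congrArg ψ h
    rw [map_mul, map_zero, mul_eq_zero] at this
    exact this.imp (fun h => hψ (h.trans (map_zero ψ).symm))
      fun h => hψ (h.trans (map_zero ψ).symm)
  induction L with
  | nil =>
    by_cases hX : Nontrivial R
    · exact ⟨1, 1, one_ne_zero, by simp, by simp⟩
    · rw [not_nontrivial_iff_subsingleton] at hX
      exact absurd (congrArg ψ (Subsingleton.elim (1 : R) 0)) (by simp)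
  | cons x L ih =>
    obtain ⟨s, p, hs, hd, hev⟩ := ih
    -- The Ore condition pulls the new denominator through the old numerator. The matrices satisfy
    -- the same identity, so no inverse of a matrix is needed.
    obtain ⟨y, y', hne, hyy⟩ := hore p (den x)
    have hy : y ≠ 0 := by
      rintro rfl
      rw [mul_zero] at hyy
      rcases hdom _ _ hyy.symm with h | h
      · exact hden x h
      · simp [h] at hne
    refine ⟨s * y, num x * y', fun h => (hdom _ _ h).elim hs hy, ?_, ?_⟩
    · rw [List.map_cons, List.prod_cons, map_mul, map_mul, mul_assoc, ← mul_assoc _ (ψ s), hd,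
        ← map_mul, hyy, map_mul, ← mul_assoc, hz]
    · filter_upwards [hev, hU x] with i hi hx
      rw [List.map_cons, List.prod_cons, List.map_cons, List.prod_cons, map_mul, map_mul,
        mul_assoc, ← mul_assoc _ (π i s), hi, smul_mul_assoc, ← map_mul, hyy, map_mul,
        mul_smul_comm, ← mul_assoc, hx, smul_mul_assoc, smul_smul, mul_comm (σ i x)]

/-- Two units of a division ring of fractions are free generators of a free group if they
specialize, after clearing denominators, to matrices over `K[X]` which at `X = 1` become rank one
matrices in general position. -/
theorem injective_lift_of_specialization {K : Type*} [Field K] [l.NeBot]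
    [∀ i, Nontrivial (m i)] (ψ : R →+* D)
    (hψ : Function.Injective ψ) (hore : ∀ r s : R, ∃ x y, (x ≠ 0 ∨ y ≠ 0) ∧ r * x = s * y)
    (π : ∀ i, R →+* Matrix (m i) (m i) K[X]) (hπ : ∀ r, r ≠ 0 → ∀ᶠ i in l, (π i r).det ≠ 0)
    {α : Type*} [DecidableEq α] (u : α → Dˣ) (num den : α → R) (hden : ∀ x, den x ≠ 0)
    (hu : ∀ x, (u x : D) * ψ (den x) = ψ (num x))
    (U : ∀ i, α × Bool → Matrix (m i) (m i) K[X]) (σ : I → α × Bool → K[X])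
    (hU : ∀ x, ∀ᶠ i in l, U i (x, true) * π i (den x) = σ i (x, true) • π i (num x))
    (hU' : ∀ x, ∀ᶠ i in l, U i (x, false) * π i (num x) = σ i (x, false) • π i (den x))
    (w g : ∀ i, α × Bool → m i → K)
    (hV : ∀ᶠ i in l, ∀ x, (evalRingHom (1 : K)).mapMatrix (U i x) =
      Matrix.vecMulVec (w i x) (g i x))
    (hw : ∀ᶠ i in l, ∀ x, w i x ≠ 0) (hg : ∀ᶠ i in l, ∀ x, g i x ≠ 0)
    (hgw : ∀ᶠ i in l, ∀ x y : α × Bool, (x.1 = y.1 → x.2 = y.2) → g i x ⬝ᵥ w i y ≠ 0) :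
    Function.Injective (FreeGroup.lift u) := by
  rw [injective_iff_map_eq_one]
  intro e he
  by_contra hne
  have hnum : ∀ x, num x ≠ 0 := by
    intro x h
    have := hu x
    rw [h, map_zero, mul_eq_zero] at this
    exact this.elim (u x).ne_zero
      fun h' => hden x (hψ (h'.trans (map_zero ψ).symm))
  obtain ⟨s, p, hs, hsp, hev⟩ := exists_fraction_specialization (l := l) ψ hψ hore π
    (fun x : α × Bool => ((cond x.2 (u x.1) (u x.1)⁻¹ : Dˣ) : D))
    (fun x => cond x.2 (num x.1) (den x.1)) (fun x => cond x.2 (den x.1) (num x.1))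
    (by rintro ⟨x, _ | _⟩; exacts [hnum x, hden x])
    (by
      rintro ⟨x, _ | _⟩
      · simp [← hu x]
      · exact hu x)
    U σ (by rintro ⟨x, _ | _⟩; exacts [hU' x, hU x]) e.toWord
  have hprod : (e.toWord.map
      (fun x : α × Bool => ((cond x.2 (u x.1) (u x.1)⁻¹ : Dˣ) : D))).prod = 1 := by
    rw [← FreeGroup.mk_toWord (x := e), FreeGroup.lift_mk] at he
    have := congrArg (Units.coeHom D) he
    rw [map_list_prod, List.map_map, map_one] at this
    exact this
  rw [hprod, one_mul] at hsp
  obtain rfl := hψ hsp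
  obtain ⟨i, hi, hdet, hVi, hwi, hgi, hgwi⟩ :=
    (hev.and ((hπ s hs).and (hV.and (hw.and (hg.and hgw))))).exists
  -- The word being `1` forces numerator and denominator to agree. Since `π i s` has nonzero
  -- determinant over `K[X]`, it can be cancelled even if it is singular at `X = 1`.
  have hUσ : (e.toWord.map (U i)).prod = (e.toWord.map (σ i)).prod • 1 := by
    have h1 : ((e.toWord.map (U i)).prod - (e.toWord.map (σ i)).prod • 1) * π i s = 0 := by
      rw [sub_mul, hi, smul_mul_assoc, one_mul, sub_self]
    have h2 := congrArg (· * (π i s).adjugate) h1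
    simp only [mul_assoc, Matrix.mul_adjugate, zero_mul, mul_smul_comm, mul_one] at h2
    exact sub_eq_zero.1 ((smul_eq_zero.1 h2).resolve_left hdet)
  obtain ⟨x, L, hL⟩ : ∃ x L, e.toWord = x :: L := by
    cases h : e.toWord with
    | nil => exact absurd (FreeGroup.toWord_eq_nil_iff.1 h) hne
    | cons x L => exact ⟨x, L, rfl⟩
  have hred : FreeGroup.IsReduced (x :: L) := hL ▸ FreeGroup.isReduced_toWord
  obtain ⟨h, h0, hh⟩ := exists_prod_eq_vecMulVec hVi hgi hgwi L x hred
  refine vecMulVec_ne_smul_one (hwi x) h0 (((x :: L).map (σ i)).prod.eval 1) ?_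
  rw [← hh]
  rw [hL] at hUσ
  have h3 := congrArg (evalRingHom (1 : K)).mapMatrix hUσ
  rw [map_list_prod, List.map_map] at h3
  refine h3.trans ?_
  ext a b
  by_cases hab : a = b <;> simp [hab]

end Specialization

/-! ### Clock, shift and Fourier matrices -/

section ClockShift

variable {K : Type*} [Field K] {n : ℕ} [NeZero n] {ω : K} (hω : IsPrimitiveRoot ω n)

/-- The additive character `j ↦ ω ^ j` of `ZMod n`. -/
noncomputable abbrev rootChar : AddChar (ZMod n) K := AddChar.zmodChar n hω.pow_eq_one

theorem rootChar_one : rootChar hω 1 = ω := by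
  simpa using AddChar.zmodChar_apply' hω.pow_eq_one 1

theorem rootChar_ne_zero (j : ZMod n) : rootChar hω j ≠ 0 := by
  rw [AddChar.zmodChar_apply]
  exact pow_ne_zero _ (hω.ne_zero (NeZero.ne n))

theorem rootChar_pow (j : ZMod n) : rootChar hω j ^ n = 1 := by
  rw [← AddChar.map_nsmul_eq_pow, nsmul_eq_mul, CharP.cast_eq_zero, zero_mul,
    AddChar.map_zero_eq_one]

theorem rootChar_eq_one_iff (j : ZMod n) : rootChar hω j = 1 ↔ j = 0 := by
  rw [AddChar.zmodChar_apply, hω.pow_eq_one_iff_dvd]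
  constructor
  · intro h
    rw [← ZMod.natCast_zmod_val j]
    exact (ZMod.natCast_eq_zero_iff _ _).2 h
  · rintro rfl
    simp

theorem rootChar_half (hn : Even n) : rootChar hω ((n / 2 : ℕ) : ZMod n) = -1 := by
  rw [AddChar.zmodChar_apply']
  have h2 : n / 2 * 2 = n := Nat.div_mul_cancel hn.two_dvd
  have h : (ω ^ (n / 2)) ^ 2 = 1 := by
    rw [← pow_mul, h2, hω.pow_eq_one]
  refine (sq_eq_one_iff.1 h).resolve_left ?_
  intro h1
  have h3 := Nat.le_of_dvd (by have := NeZero.pos n; omega) ((hω.pow_eq_one_iff_dvd _).1 h1)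
  have := NeZero.pos n
  omega

/-- The diagonal matrix of the powers of `ω`. -/
noncomputable def clockMatrix : Matrix (ZMod n) (ZMod n) K := Matrix.diagonal (rootChar hω)

/-- The matrix whose columns are eigenvectors of the cyclic shift. -/
noncomputable def fourierMatrix : Matrix (ZMod n) (ZMod n) K :=
  Matrix.of fun i j => rootChar hω (-(i * j))

/-- The inverse of `fourierMatrix`. -/
noncomputable def fourierMatrixInv : Matrix (ZMod n) (ZMod n) K :=
  Matrix.of fun i j => (n : K)⁻¹ * rootChar hω (i * j)

theorem fourierMatrix_mul_inv (hn : (n : K) ≠ 0) :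
    fourierMatrix hω * fourierMatrixInv hω = 1 := by
  ext i j
  have h : ∀ l : ZMod n, rootChar hω (-(i * l)) * ((n : K)⁻¹ * rootChar hω (l * j)) =
      (n : K)⁻¹ * rootChar hω (l * (j - i)) := by
    intro l
    rw [show l * (j - i) = -(i * l) + l * j by ring, AddChar.map_add_eq_mul]
    ring
  simp only [Matrix.mul_apply, fourierMatrix, fourierMatrixInv, Matrix.of_apply, h]
  rw [← Finset.mul_sum, AddChar.sum_mulShift _
    (AddChar.zmodChar_primitive_of_primitive_root n hω), Matrix.one_apply]
  by_cases hij : i = j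
  · simp [hij, hn]
  · rw [if_neg (by rw [sub_eq_zero]; exact fun h => hij h.symm), if_neg hij]
    simp

theorem fourierMatrixInv_mul (hn : (n : K) ≠ 0) :
    fourierMatrixInv hω * fourierMatrix hω = 1 :=
  mul_eq_one_comm.1 (fourierMatrix_mul_inv hω hn)

/-- The cyclic shift matrix. -/
noncomputable def shiftMatrix : Matrix (ZMod n) (ZMod n) K :=
  fourierMatrix hω * clockMatrix hω * fourierMatrixInv hω

theorem shiftMatrix_apply (hn : (n : K) ≠ 0) (i j : ZMod n) :
    shiftMatrix hω i j = if i = j + 1 then 1 else 0 := by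
  have h : ∀ l : ZMod n, rootChar hω (-(i * l)) * rootChar hω l *
      ((n : K)⁻¹ * rootChar hω (l * j)) = (n : K)⁻¹ * rootChar hω (l * (j + 1 - i)) := by
    intro l
    rw [show l * (j + 1 - i) = -(i * l) + l + l * j by ring, AddChar.map_add_eq_mul,
      AddChar.map_add_eq_mul]
    ring
  rw [shiftMatrix, Matrix.mul_apply]
  simp only [clockMatrix, Matrix.mul_diagonal, fourierMatrix, fourierMatrixInv, Matrix.of_apply, h]
  rw [← Finset.mul_sum, AddChar.sum_mulShift _
    (AddChar.zmodChar_primitive_of_primitive_root n hω)]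
  by_cases hij : i = j + 1
  · simp [hij, hn]
  · rw [if_neg (by rw [sub_eq_zero]; exact fun h => hij h.symm), if_neg hij]
    simp

theorem clockMatrix_mul_shiftMatrix (hn : (n : K) ≠ 0) :
    clockMatrix hω * shiftMatrix hω = ω • (shiftMatrix hω * clockMatrix hω) := by
  ext i j
  simp only [clockMatrix, Matrix.diagonal_mul, Matrix.smul_apply, Matrix.mul_diagonal,
    shiftMatrix_apply hω hn]
  split_ifs with h
  · rw [h, AddChar.map_add_eq_mul, rootChar_one, smul_eq_mul]
    ring
  · simp

theorem det_clockMatrix_ne_zero : (clockMatrix hω).det ≠ 0 := by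
  rw [clockMatrix, Matrix.det_diagonal]
  exact Finset.prod_ne_zero_iff.2 fun j _ => rootChar_ne_zero hω j

theorem det_shiftMatrix_ne_zero (hn : (n : K) ≠ 0) : (shiftMatrix hω).det ≠ 0 := by
  have h := congrArg Matrix.det (fourierMatrix_mul_inv hω hn)
  rw [Matrix.det_mul, Matrix.det_one] at h
  rw [shiftMatrix, Matrix.det_mul, Matrix.det_mul, mul_right_comm, h, one_mul]
  exact det_clockMatrix_ne_zero hω

end ClockShift

/-! ### Letters that degenerate to rank one -/

section Letters

variable {m K : Type*} [Fintype m] [DecidableEq m] [Field K]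

theorem diagonal_mul_prod_erase {A : Type*} [CommRing A] (p q : m → A) :
    Matrix.diagonal (fun j => p j * ∏ i ∈ Finset.univ.erase j, q i) * Matrix.diagonal q =
      (∏ i, q i) • Matrix.diagonal p := by
  rw [Matrix.diagonal_mul_diagonal, ← Matrix.diagonal_smul]
  congr 1
  ext j
  rw [Pi.smul_apply, smul_eq_mul, ← Finset.prod_erase_mul _ _ (Finset.mem_univ j)]
  ring

theorem aeval_conj_diagonal {A : Type*} [CommRing A] [Algebra K A] {P P' : Matrix m m A}
    (hP : P' * P = 1) (hP' : P * P' = 1) (y : m → A) (F : K[X]) :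
    aeval (P * Matrix.diagonal y * P') F = P * Matrix.diagonal (fun j => aeval (y j) F) * P' := by
  induction F using Polynomial.induction_on' with
  | add F G hF hG =>
    simp only [map_add, hF, hG]
    rw [← Matrix.diagonal_add, mul_add, add_mul]
  | monomial d c =>
    have hpow : (P * Matrix.diagonal y * P') ^ d = P * Matrix.diagonal y ^ d * P' :=
      Units.conj_pow ⟨P, P', hP', hP⟩ (Matrix.diagonal y) d
    have hd : (Matrix.diagonal fun j => aeval (y j) (monomial d c)) =
        c • Matrix.diagonal y ^ d := by
      rw [Matrix.diagonal_pow, ← Matrix.diagonal_smul]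
      congr 1
      ext j
      simp [aeval_monomial, Algebra.smul_def]
    rw [aeval_monomial, hpow, hd, ← Algebra.smul_def, mul_smul_comm, smul_mul_assoc]

theorem eval_aeval_one (y F : K[X]) : (aeval y F).eval 1 = F.eval (y.eval 1) := by
  rw [← coe_aeval_eq_eval, ← coe_aeval_eq_eval, ← aeval_algHom_apply]

/-- Used to see that numerators and denominators of letters are nonzero in the Heisenberg algebra,
since they have a nonzero image. -/
theorem aeval_conj_diagonal_ne_zero {P P' : Matrix m m K} (hP : P' * P = 1) (y : m → K[X])
    (F : K[X]) (j : m) (h : F.eval ((y j).eval 1) ≠ 0) {M : Matrix m m K[X]}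
    (hM : M = C.mapMatrix P * Matrix.diagonal y * C.mapMatrix P') : aeval M F ≠ 0 := by
  have hP1 : C.mapMatrix P' * C.mapMatrix P = 1 := by rw [← map_mul, hP, map_one]
  have hP2 : C.mapMatrix P * C.mapMatrix P' = 1 := mul_eq_one_comm.1 hP1
  intro h0
  rw [hM, aeval_conj_diagonal hP1 hP2] at h0
  have h1 := congrArg (fun Z => C.mapMatrix P' * Z * C.mapMatrix P) h0
  simp only [mul_zero, zero_mul] at h1
  rw [mul_assoc, mul_assoc, hP1, mul_one, ← mul_assoc, hP1, one_mul] at h1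
  have h2 := congrFun (congrFun h1 j) j
  rw [Matrix.diagonal_apply_eq, Matrix.zero_apply] at h2
  rw [← eval_aeval_one, h2, eval_zero] at h
  exact h rfl

/-- Clearing denominators in `F₁ (M) * (F₂ (M))⁻¹` for a diagonalizable matrix `M` yields a matrix
which at `X = 1` has rank one, provided `F₂` vanishes at exactly one eigenvalue. -/
theorem exists_cleared_fraction (P P' : Matrix m m K) (hP : P' * P = 1) (y : m → K[X])
    (F₁ F₂ : K[X]) (j : m) (h1 : F₁.eval ((y j).eval 1) ≠ 0)
    (h2 : ∀ i, F₂.eval ((y i).eval 1) = 0 ↔ i = j) {M : Matrix m m K[X]}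
    (hM : M = C.mapMatrix P * Matrix.diagonal y * C.mapMatrix P') :
    ∃ (U : Matrix m m K[X]) (σ : K[X]) (c : K), c ≠ 0 ∧
      U * aeval M F₂ = σ • aeval M F₁ ∧
      (evalRingHom (1 : K)).mapMatrix U = Matrix.vecMulVec (c • P.col j) (P'.row j) := by
  have hP1 : C.mapMatrix P' * C.mapMatrix P = 1 := by rw [← map_mul, hP, map_one]
  have hP2 : C.mapMatrix P * C.mapMatrix P' = 1 := mul_eq_one_comm.1 hP1
  -- Up to conjugation by `P`, this is `F₁ (M) * F₂ (M)⁻¹` multiplied by the product of all `F₂ (y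
  -- i)`. At `X = 1` the factor `F₂ (y j)` vanishes and kills every diagonal entry except the
  -- `j`-th, from which it is omitted.
  refine ⟨C.mapMatrix P * Matrix.diagonal (fun j => aeval (y j) F₁ *
    ∏ i ∈ Finset.univ.erase j, aeval (y i) F₂) * C.mapMatrix P', ∏ i, aeval (y i) F₂,
    F₁.eval ((y j).eval 1) * ∏ i ∈ Finset.univ.erase j, F₂.eval ((y i).eval 1), ?_, ?_, ?_⟩
  · refine mul_ne_zero h1 (Finset.prod_ne_zero_iff.2 fun i hi => ?_)
    rw [Ne, h2]
    exact Finset.ne_of_mem_erase hi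
  · rw [hM, aeval_conj_diagonal hP1 hP2, aeval_conj_diagonal hP1 hP2, ← smul_mul_assoc,
      ← mul_smul_comm, ← diagonal_mul_prod_erase]
    simp only [mul_assoc]
    rw [← mul_assoc (C.mapMatrix P') (C.mapMatrix P), hP1, one_mul]
  · have hPe : ∀ Q : Matrix m m K, (evalRingHom (1 : K)).mapMatrix (C.mapMatrix Q) = Q := by
      intro Q
      ext a b
      simp
    rw [map_mul, map_mul, hPe, hPe]
    have hd : (evalRingHom (1 : K)).mapMatrix (Matrix.diagonal (fun j => aeval (y j) F₁ *
        ∏ i ∈ Finset.univ.erase j, aeval (y i) F₂)) = Matrix.diagonal (Pi.single j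
          (F₁.eval ((y j).eval 1) * ∏ i ∈ Finset.univ.erase j, F₂.eval ((y i).eval 1))) := by
      rw [RingHom.mapMatrix_apply, Matrix.diagonal_map (map_zero _)]
      congr 1
      ext i
      simp only [coe_evalRingHom, eval_mul, eval_prod, eval_aeval_one]
      by_cases hij : i = j
      · subst hij
        simp
      · rw [Pi.single_eq_of_ne hij]
        refine mul_eq_zero_of_right _ (Finset.prod_eq_zero (i := j) ?_ ((h2 j).2 rfl))
        exact Finset.mem_erase.2 ⟨Ne.symm hij, Finset.mem_univ _⟩
    rw [hd]
    ext a b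
    rw [Matrix.mul_apply, Finset.sum_eq_single j]
    · simp [Matrix.vecMulVec_apply, mul_comm]
    · intro i _ hij
      simp [Pi.single_eq_of_ne hij]
    · simp

end Letters

/-- `α` is a nonzero root of `F` and no other `α * ζ` with `ζ ^ n = 1` is a root. -/
def IsSeparatedRoot {K : Type*} [Field K] (n : ℕ) (F : K[X]) (α : K) : Prop :=
  F.eval α = 0 ∧ ∀ ζ : K, ζ ^ n = 1 → ζ ≠ 1 → F.eval (α * ζ) ≠ 0

/-! ### Clock and shift representations and the freeness criterion -/

namespace HeisenbergAlgebra

variable {k K : Type*} [Field k] [Field K] [Algebra k K]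

section ClockShift

variable {n : ℕ} [NeZero n] {ω : K} (hω : IsPrimitiveRoot ω n)

/-- The representation of the Heisenberg algebra by clock and shift matrices. -/
noncomputable def clockShift (hn : (n : K) ≠ 0) (α β : K) :
    HeisenbergAlgebra k →ₐ[k] Matrix (ZMod n) (ZMod n) K[X] :=
  -- The powers `X` and `X ^ n` separate monomials by weight near `X = 0`. At `X = 1` they disappear
  -- and leave the eigenvalues `α ω ^ j` and `β ω ^ j`.
  lift ((X : K[X]) • C.mapMatrix (α • clockMatrix hω))
    ((X ^ n : K[X]) • C.mapMatrix (β • shiftMatrix hω)) (algebraMap K _ ω)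
    (by
      have h : C.mapMatrix (α • clockMatrix hω) * C.mapMatrix (β • shiftMatrix hω) =
          ω • (C.mapMatrix (β • shiftMatrix hω) * C.mapMatrix (α • clockMatrix hω)) := by
        rw [← map_mul, ← map_mul, smul_mul_smul_comm, clockMatrix_mul_shiftMatrix hω hn,
          smul_mul_smul_comm, mul_comm α]
        ext1 i j
        simp [smul_eq_C_mul]
        ring
      rw [smul_mul_smul_comm, h, ← Algebra.smul_def, smul_mul_assoc, smul_mul_smul_comm,
        mul_comm (X : K[X]), smul_comm])
    (Algebra.commutes _ _) (Algebra.commutes _ _)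

variable (hn : (n : K) ≠ 0) (α β : K)

theorem clockShift_genC : clockShift hω hn α β (genC k) = algebraMap K _ ω := lift_genC ..

theorem clockShift_genA : clockShift hω hn α β (genA k) =
    (X : K[X]) • C.mapMatrix (α • clockMatrix hω) := lift_genA ..

theorem clockShift_genB : clockShift hω hn α β (genB k) =
    (X ^ n : K[X]) • C.mapMatrix (β • shiftMatrix hω) := lift_genB ..

theorem clockShift_genA_eq_conj : clockShift hω hn α β (genA k) =
    C.mapMatrix (1 : Matrix (ZMod n) (ZMod n) K) *
      Matrix.diagonal (fun j => C (α * rootChar hω j) * X) *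
        C.mapMatrix (1 : Matrix (ZMod n) (ZMod n) K) := by
  rw [clockShift_genA, map_one, one_mul, mul_one]
  ext1 i j
  by_cases h : i = j
  · simp [clockMatrix, h, mul_comm]
  · simp [clockMatrix, h]

theorem clockShift_genB_eq_conj : clockShift hω hn α β (genB k) =
    C.mapMatrix (fourierMatrix hω) *
      Matrix.diagonal (fun j => C (β * rootChar hω j) * X ^ n) *
        C.mapMatrix (fourierMatrixInv hω) := by
  have h : Matrix.diagonal (fun j => C (β * rootChar hω j) * X ^ n) =
      (X ^ n : K[X]) • C.mapMatrix (β • clockMatrix hω) := by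
    ext1 i j
    by_cases h : i = j
    · simp [clockMatrix, h, mul_comm]
    · simp [clockMatrix, h]
  rw [clockShift_genB, h, mul_smul_comm, smul_mul_assoc, ← map_mul, ← map_mul, shiftMatrix,
    mul_smul_comm, smul_mul_assoc]

/-- Both letters `F (M) * (F (-M))⁻¹` and its inverse, cleared of denominators. -/
theorem exists_letters (hn2 : Even n) {P P' : Matrix (ZMod n) (ZMod n) K} (hP : P' * P = 1)
    {F : K[X]} {α : K} (hF : IsSeparatedRoot n F α) (d : ℕ) {M : Matrix (ZMod n) (ZMod n) K[X]}
    (hM : M = C.mapMatrix P * Matrix.diagonal (fun j => C (α * rootChar hω j) * X ^ d) *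
      C.mapMatrix P') :
    ∃ (U : Bool → Matrix (ZMod n) (ZMod n) K[X]) (σ : Bool → K[X]) (c : Bool → K),
      (∀ s, c s ≠ 0) ∧ aeval M F ≠ 0 ∧ aeval M (F.comp (-X)) ≠ 0 ∧
      U true * aeval M (F.comp (-X)) = σ true • aeval M F ∧
      U false * aeval M F = σ false • aeval M (F.comp (-X)) ∧
      ∀ s, (evalRingHom (1 : K)).mapMatrix (U s) = Matrix.vecMulVec
        (c s • P.col (cond s ((n / 2 : ℕ) : ZMod n) 0)) (P'.row (cond s ((n / 2 : ℕ) : ZMod n) 0)) := by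
  set h : ZMod n := ((n / 2 : ℕ) : ZMod n)
  have hh : rootChar hω h = -1 := rootChar_half hω hn2
  have hneg : (-1 : K) ≠ 1 := by
    rw [← hh, Ne, rootChar_eq_one_iff, ZMod.natCast_eq_zero_iff]
    intro hdvd
    have hpos := NeZero.pos n
    have h2 := hn2.two_dvd
    have := Nat.le_of_dvd (by omega) hdvd
    omega
  -- Since `n` is even, `-1` is the value of the character at `n / 2`, so passing from `F` to `F
  -- (-X)` shifts the eigenvalue index by `n / 2`.
  have hval : ∀ j, (F.comp (-X)).eval ((C (α * rootChar hω j) * X ^ d : K[X]).eval 1) =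
      F.eval (α * rootChar hω (j + h)) := by
    intro j
    rw [AddChar.map_add_eq_mul, hh]
    simp
  have hval' : ∀ j, F.eval ((C (α * rootChar hω j) * X ^ d : K[X]).eval 1) =
      F.eval (α * rootChar hω j) := by
    intro j
    simp
  have hzero : ∀ j, F.eval (α * rootChar hω j) = 0 ↔ j = 0 := by
    intro j
    constructor
    · intro h0
      by_contra hj
      exact hF.2 _ (rootChar_pow hω j) (fun h1 => hj ((rootChar_eq_one_iff hω j).1 h1)) h0
    · rintro rfl
      simpa using hF.1
  have hhh : h + h = 0 := by
    rw [← rootChar_eq_one_iff hω, AddChar.map_add_eq_mul, hh]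
    ring
  have hh0 : h ≠ 0 := by
    rw [Ne, ← rootChar_eq_one_iff hω, hh]
    exact hneg
  obtain ⟨U₁, σ₁, c₁, hc₁, hU₁, hE₁⟩ := exists_cleared_fraction P P' hP _ F (F.comp (-X)) h
    (by rw [hval', Ne, hzero]; exact hh0)
    (fun i => by rw [hval, hzero, add_eq_zero_iff_eq_neg, ← eq_neg_of_add_eq_zero_left hhh]) hM
  obtain ⟨U₂, σ₂, c₂, hc₂, hU₂, hE₂⟩ := exists_cleared_fraction P P' hP _ (F.comp (-X)) F 0
    (by rw [hval, Ne, hzero, zero_add]; exact hh0) (fun i => by rw [hval', hzero]) hM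
  refine ⟨fun s => cond s U₁ U₂, fun s => cond s σ₁ σ₂, fun s => cond s c₁ c₂, ?_,
    aeval_conj_diagonal_ne_zero hP _ F h (by rw [hval', Ne, hzero]; exact hh0) hM,
    aeval_conj_diagonal_ne_zero hP _ _ 0 (by rw [hval, Ne, hzero, zero_add]; exact hh0) hM,
    hU₁, hU₂, ?_⟩
  · rintro (_ | _)
    exacts [hc₂, hc₁]
  · rintro (_ | _)
    exacts [hE₂, hE₁]

end ClockShift

section Free

variable {n : ℕ → ℕ} [∀ i, NeZero (n i)] {ω : ℕ → K}

theorem eventually_clockShift_det_ne_zero (hω : ∀ i, IsPrimitiveRoot (ω i) (n i))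
    (hn : ∀ i, (n i : K) ≠ 0) (htop : Tendsto n atTop atTop)
    {α β : ℕ → K} (hα : ∀ i, α i ≠ 0) (hβ : ∀ i, β i ≠ 0)
    {r : HeisenbergAlgebra k} (hr : r ≠ 0) :
    ∀ᶠ i in atTop, (clockShift (hω i) (hn i) (α i) (β i) r).det ≠ 0 := by
  have hord : ∀ i, orderOf (ω i) = n i := fun i => (hω i).eq_orderOf.symm
  have hdet : ∀ i (Q : Matrix (ZMod (n i)) (ZMod (n i)) K), (C.mapMatrix Q).det.eval 0 = Q.det := by
    intro i Q
    rw [← RingHom.map_det, eval_C]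
  refine eventually_det_ne_zero (fun i => clockShift (hω i) (hn i) (α i) (β i)) (ω := ω)
    (by simpa only [hord] using htop) (fun i => clockShift_genC ..)
    (fun i => clockShift_genA ..) (fun i => by rw [hord]; exact clockShift_genB ..) ?_ ?_ hr
  · intro i
    rw [hdet, Matrix.det_smul]
    exact mul_ne_zero (pow_ne_zero _ (hα i)) (det_clockMatrix_ne_zero _)
  · intro i
    rw [hdet, Matrix.det_smul]
    exact mul_ne_zero (pow_ne_zero _ (hβ i)) (det_shiftMatrix_ne_zero _ (hn i))

/-- On all specializations, `p` and `q` are the values at `g` of polynomials `F` and `F (-X)`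
with a separated root. -/
def IsLetter (n : ℕ → ℕ) [∀ i, NeZero (n i)] (ω : ℕ → K) (g p q : HeisenbergAlgebra k)
    (F : ℕ → K[X]) : Prop :=
  (∀ i (f : HeisenbergAlgebra k →ₐ[k] Matrix (ZMod (n i)) (ZMod (n i)) K[X]),
    f (genC k) = algebraMap K _ (ω i) →
      f p = aeval (f g) (F i) ∧ f q = aeval (f g) ((F i).comp (-X))) ∧
  ∀ᶠ i in atTop, ∃ α : K, α ≠ 0 ∧ IsSeparatedRoot (n i) (F i) α

theorem IsLetter.exists_seq {g p q : HeisenbergAlgebra k} {F : ℕ → K[X]}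
    (h : IsLetter n ω g p q F) : ∃ α : ℕ → K, (∀ i, α i ≠ 0) ∧
      ∀ᶠ i in atTop, IsSeparatedRoot (n i) (F i) (α i) := by
  have h1 : ∀ i, ∃ α : K, α ≠ 0 ∧ ((∃ α : K, α ≠ 0 ∧ IsSeparatedRoot (n i) (F i) α) →
      IsSeparatedRoot (n i) (F i) α) := by
    intro i
    by_cases hi : ∃ α : K, α ≠ 0 ∧ IsSeparatedRoot (n i) (F i) α
    · exact ⟨hi.choose, hi.choose_spec.1, fun _ => hi.choose_spec.2⟩
    -- Where no separated root exists, `1` keeps `α` nonzero for every index, as the determinant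
    -- argument requires.
    · exact ⟨1, one_ne_zero, fun h => absurd h hi⟩
  choose α hα hα' using h1
  exact ⟨α, hα, h.2.mono hα'⟩

/-- The fractions `p * q⁻¹` and `p' * q'⁻¹` given by letters in `a` and in `b` form a free pair. -/
theorem exists_isFreePair (hω : ∀ i, IsPrimitiveRoot (ω i) (n i))
    (hn : ∀ i, (n i : K) ≠ 0) (htop : Tendsto n atTop atTop)
    (hn2 : ∀ i, Even (n i)) {D : Type*} [DivisionRing D] [Algebra k D]
    (ψ : HeisenbergAlgebra k →ₐ[k] D) (hψ : Function.Injective ψ)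
    {p q p' q' : HeisenbergAlgebra k} {F G : ℕ → K[X]}
    (hF : IsLetter n ω (genA k) p q F) (hG : IsLetter n ω (genB k) p' q' G) :
    ∃ u v : Dˣ, u * ψ q = ψ p ∧ v * ψ q' = ψ p' ∧ ψ q ≠ 0 ∧ ψ q' ≠ 0 ∧ IsFreePair u v := by
  obtain ⟨α, hα, hαF⟩ := hF.exists_seq
  obtain ⟨β, hβ, hβG⟩ := hG.exists_seq
  let π : ∀ i, HeisenbergAlgebra k →ₐ[k] Matrix (ZMod (n i)) (ZMod (n i)) K[X] :=
    fun i => clockShift (hω i) (hn i) (α i) (β i)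
  have hπC : ∀ i, π i (genC k) = algebraMap K _ (ω i) := fun i => clockShift_genC ..
  let P : ∀ i, Bool → Matrix (ZMod (n i)) (ZMod (n i)) K := fun i x =>
    cond x 1 (fourierMatrix (hω i))
  let P' : ∀ i, Bool → Matrix (ZMod (n i)) (ZMod (n i)) K := fun i x =>
    cond x 1 (fourierMatrixInv (hω i))
  have hP : ∀ i x, P' i x * P i x = 1 := by
    rintro i (_ | _)
    exacts [fourierMatrixInv_mul (hω i) (hn i), one_mul 1]
  let num : Bool → HeisenbergAlgebra k := fun x => cond x p p'
  let den : Bool → HeisenbergAlgebra k := fun x => cond x q q'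
  let j : ∀ i, Bool → ZMod (n i) := fun i s => cond s ((n i / 2 : ℕ) : ZMod (n i)) 0
  have hex : ∀ x i, ∃ (U : Bool → Matrix (ZMod (n i)) (ZMod (n i)) K[X]) (σ : Bool → K[X])
      (c : Bool → K), IsSeparatedRoot (n i) (cond x (F i) (G i)) (cond x (α i) (β i)) →
      (∀ s, c s ≠ 0) ∧ π i (num x) ≠ 0 ∧ π i (den x) ≠ 0 ∧
      U true * π i (den x) = σ true • π i (num x) ∧
      U false * π i (num x) = σ false • π i (den x) ∧
      ∀ s, (evalRingHom (1 : K)).mapMatrix (U s) =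
        Matrix.vecMulVec (c s • (P i x).col (j i s)) ((P' i x).row (j i s)) := by
    intro x i
    by_cases hx : IsSeparatedRoot (n i) (cond x (F i) (G i)) (cond x (α i) (β i))
    · cases x with
      | true =>
        obtain ⟨h1, h2⟩ := hF.1 i (π i) (hπC i)
        obtain ⟨U, σ, c, h⟩ := exists_letters (hω i) (hn2 i) (hP i true) hx 1
          (M := π i (genA k))
          (by simp only [pow_one]; exact clockShift_genA_eq_conj (hω i) (hn i) (α i) (β i))
        refine ⟨U, σ, c, fun _ => ?_⟩
        simp only [num, den, cond_true, h1, h2]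
        exact h
      | false =>
        obtain ⟨h1, h2⟩ := hG.1 i (π i) (hπC i)
        obtain ⟨U, σ, c, h⟩ := exists_letters (hω i) (hn2 i) (hP i false) hx (n i)
          (M := π i (genB k)) (clockShift_genB_eq_conj (hω i) (hn i) (α i) (β i))
        refine ⟨U, σ, c, fun _ => ?_⟩
        simp only [num, den, cond_false, h1, h2]
        exact h
    -- Junk values, used only at indices without a separated root, which are eventually absent.
    · exact ⟨0, 0, 0, fun h => absurd h hx⟩
  choose U σ c hUσ using hex
  have hev : ∀ x, ∀ᶠ i in atTop,
      IsSeparatedRoot (n i) (cond x (F i) (G i)) (cond x (α i) (β i)) := by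
    rintro (_ | _)
    exacts [hβG, hαF]
  have hnum : ∀ x, num x ≠ 0 := by
    intro x h0
    obtain ⟨i, hi⟩ := (hev x).exists
    exact (hUσ x i hi).2.1 (by rw [h0, map_zero])
  have hden : ∀ x, den x ≠ 0 := by
    intro x h0
    obtain ⟨i, hi⟩ := (hev x).exists
    exact (hUσ x i hi).2.2.1 (by rw [h0, map_zero])
  have hψ0 : ∀ r, r ≠ 0 → ψ r ≠ 0 := fun r hr h => hr (hψ (h.trans (map_zero ψ).symm))
  let u : Bool → Dˣ := fun x =>
    Units.mk0 (ψ (num x) * (ψ (den x))⁻¹)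
      (mul_ne_zero (hψ0 _ (hnum x)) (inv_ne_zero (hψ0 _ (hden x))))
  have hu : ∀ x, (u x : D) * ψ (den x) = ψ (num x) := fun x =>
    inv_mul_cancel_right₀ (hψ0 _ (hden x)) _
  refine ⟨u true, u false, hu true, hu false, hψ0 _ (hden true), hψ0 _ (hden false),
    isFreePair_of_injective_lift u ?_⟩
  have hall : ∀ᶠ i in atTop, ∀ x,
      IsSeparatedRoot (n i) (cond x (F i) (G i)) (cond x (α i) (β i)) :=
    Filter.eventually_all.2 hev
  have : ∀ i, Nontrivial (ZMod (n i)) := fun i => by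
    have h1 : 1 < n i := by
      have := (hn2 i).two_dvd
      have := NeZero.pos (n i)
      omega
    have : Fact (1 < n i) := ⟨h1⟩
    infer_instance
  -- General position: for one generator the pairing is a diagonal entry of `P' * P = 1`, and for
  -- different generators it is an entry of the Fourier matrix or of its inverse, never zero.
  have hPne : ∀ i x y s t, ((x, s).1 = (y, t).1 → (x, s).2 = (y, t).2) →
      (P' i x).row (j i s) ⬝ᵥ (P i y).col (j i t) ≠ 0 := by
    intro i x y s t hxy
    change (P' i x * P i y) (j i s) (j i t) ≠ 0
    rcases x with _ | _ <;> rcases y with _ | _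
    · obtain rfl : s = t := hxy rfl
      rw [hP, Matrix.one_apply_eq]
      exact one_ne_zero
    · simp only [P, P', cond_true, cond_false, mul_one, fourierMatrixInv, Matrix.of_apply]
      exact mul_ne_zero (inv_ne_zero (hn i)) (rootChar_ne_zero _ _)
    · simp only [P, P', cond_true, cond_false, one_mul, fourierMatrix, Matrix.of_apply]
      exact rootChar_ne_zero _ _
    · obtain rfl : s = t := hxy rfl
      rw [hP, Matrix.one_apply_eq]
      exact one_ne_zero
  let π' : ∀ i, HeisenbergAlgebra k →+* Matrix (ZMod (n i)) (ZMod (n i)) K[X] := fun i => π i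
  let U' : ∀ i, Bool × Bool → Matrix (ZMod (n i)) (ZMod (n i)) K[X] := fun i x => U x.1 i x.2
  let σ' : ℕ → Bool × Bool → K[X] := fun i x => σ x.1 i x.2
  let w : ∀ i, Bool × Bool → ZMod (n i) → K := fun i x =>
    c x.1 i x.2 • (P i x.1).col (j i x.2)
  let g : ∀ i, Bool × Bool → ZMod (n i) → K := fun i x => (P' i x.1).row (j i x.2)
  have hdet : ∀ r : HeisenbergAlgebra k, r ≠ 0 →
      ∀ᶠ i in atTop, (π' i r).det ≠ 0 := fun r hr =>
    eventually_clockShift_det_ne_zero hω hn htop hα hβ hr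
  have hU1 : ∀ x, ∀ᶠ i in atTop, U' i (x, true) * π' i (den x) =
      σ' i (x, true) • π' i (num x) := fun x =>
    (hev x).mono fun i hi => (hUσ x i hi).2.2.2.1
  have hU2 : ∀ x, ∀ᶠ i in atTop, U' i (x, false) * π' i (num x) =
      σ' i (x, false) • π' i (den x) := fun x =>
    (hev x).mono fun i hi => (hUσ x i hi).2.2.2.2.1
  have hV : ∀ᶠ i in atTop, ∀ x, (evalRingHom (1 : K)).mapMatrix (U' i x) =
      Matrix.vecMulVec (w i x) (g i x) :=
    hall.mono fun i hi x => (hUσ x.1 i (hi x.1)).2.2.2.2.2 x.2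
  have hw : ∀ᶠ i in atTop, ∀ x, w i x ≠ 0 := by
    filter_upwards [hall] with i hi x
    refine smul_ne_zero ((hUσ x.1 i (hi x.1)).1 x.2) fun h0 => ?_
    refine hPne i x.1 x.1 x.2 x.2 (fun _ => rfl) ?_
    rw [h0, dotProduct_zero]
  have hg : ∀ᶠ i in atTop, ∀ x, g i x ≠ 0 := by
    refine Filter.Eventually.of_forall fun i x h0 => hPne i x.1 x.1 x.2 x.2 (fun _ => rfl) ?_
    change g i x ⬝ᵥ _ = 0
    rw [h0, zero_dotProduct]
  have hgw : ∀ᶠ i in atTop, ∀ x y : Bool × Bool, (x.1 = y.1 → x.2 = y.2) →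
      g i x ⬝ᵥ w i y ≠ 0 := by
    filter_upwards [hall] with i hi x y hxy
    rw [dotProduct_smul]
    exact smul_ne_zero ((hUσ y.1 i (hi y.1)).1 y.2) (hPne i x.1 y.1 x.2 y.2 hxy)
  clear_value U' σ' w g num den u π'
  exact injective_lift_of_specialization (l := atTop) (ψ : HeisenbergAlgebra k →+* D) hψ
    exists_mul_eq_mul π' hdet u num den hden hu
    U' σ' hU1 hU2 w g hV hw hg hgw

end Free

end HeisenbergAlgebra

/-! ### Choice of the roots of unity -/

theorem exists_primitiveRoot_of_isAlgClosed (K : Type*) [Field K] [IsAlgClosed K] {n : ℕ}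
    (hn : (n : K) ≠ 0) : ∃ ω : K, IsPrimitiveRoot ω n := by
  have : NeZero (n : K) := ⟨hn⟩
  exact HasEnoughRootsOfUnity.exists_primitiveRoot K n

/-- A sequence of primitive roots of unity of even orders tending to infinity. The second part
says that some quotient `η / δ` of polynomials in the root is nonzero and not a root of unity of
twice the same order. -/
theorem exists_rootSequence (k K : Type*) [Field k] [Field K] [Algebra k K] [IsAlgClosed K]
    (hk : ringChar k ≠ 2) :
    ∃ (n : ℕ → ℕ) (ω : ℕ → K), (∀ i, n i ≠ 0) ∧ (∀ i, IsPrimitiveRoot (ω i) (n i)) ∧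
      (∀ i, (n i : K) ≠ 0) ∧ Tendsto n atTop atTop ∧ (∀ i, Even (n i)) ∧
      ∃ δ η : k[X], ((δ = 1 ∧ η = 2) ∨ (δ = X ∧ η = X ^ 2 + 1)) ∧
        ∀ᶠ i in atTop, aeval (ω i) δ ≠ 0 ∧ aeval (ω i) η ≠ 0 ∧
          (aeval (ω i) η / aeval (ω i) δ) ^ (2 * n i) ≠ 1 := by
  rcases CharP.exists k with ⟨p, hp⟩
  have hpK : CharP K p := charP_of_injective_algebraMap (algebraMap k K).injective p
  rcases CharP.char_is_prime_or_zero k p with hprime | rfl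
  -- In characteristic `p` a constant may fail: over the field with three elements, every nonzero
  -- `t` satisfies `t ^ 4 = 1`. The choice is `t = ω + ω⁻¹` with `n = p ^ (i + 1) + 1`, which is
  -- even and prime to `p`.
  · have : Fact p.Prime := ⟨hprime⟩
    have hp2 : p ≠ 2 := fun h => hk (by rw [ringChar.eq k p, h])
    have hn : ∀ i, ((p ^ (i + 1) + 1 : ℕ) : K) ≠ 0 := by
      intro i
      push_cast
      simp
    choose ω hω using fun i => exists_primitiveRoot_of_isAlgClosed K (hn i)
    have htop : Tendsto (fun i => p ^ (i + 1) + 1) atTop atTop := by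
      refine tendsto_atTop_mono (fun i => ?_) tendsto_id
      have := (i + 1).lt_pow_self hprime.one_lt
      simp only [id]
      omega
    refine ⟨fun i => p ^ (i + 1) + 1, ω, fun i => Nat.succ_ne_zero _, hω, hn, htop, ?_,
      X, X ^ 2 + 1, Or.inr ⟨rfl, rfl⟩, ?_⟩
    · intro i
      exact ((hprime.odd_of_ne_two hp2).pow).add_one
    · have hord : Tendsto (fun i => orderOf (ω i)) atTop atTop := by
        simpa only [← (hω _).eq_orderOf] using htop
      have h1 : ((X ^ 2 + 1 : K[X])) ≠ 0 := by
        intro h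
        simpa using congrArg (fun f => f.coeff 0) h
      have h2 : ((X ^ 2 + 1) ^ 4 - X ^ 4 : K[X]) ≠ 0 := by
        intro h
        simpa using congrArg (fun f => f.eval 0) h
      filter_upwards [eventually_eval_ne_zero_of_tendsto_orderOf hord h1,
        eventually_eval_ne_zero_of_tendsto_orderOf hord h2] with i hi1 hi2
      have h0 : ω i ≠ 0 := (hω i).ne_zero (Nat.succ_ne_zero _)
      simp only [map_add, map_pow, aeval_X, map_one]
      simp only [eval_add, eval_pow, eval_X, eval_one, eval_sub] at hi1 hi2
      refine ⟨h0, hi1, ?_⟩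
      -- This power of Frobenius inverts `ω`, hence fixes `t = ω + ω⁻¹`. Thus `t ^ (2 * n) = t ^ 4`,
      -- and `t ^ 4 = 1` is a fixed polynomial equation in `ω`, which eventually fails.
      have hfix : ((ω i ^ 2 + 1) / ω i) ^ p ^ (i + 1) = (ω i ^ 2 + 1) / ω i := by
        have hinv : ω i ^ p ^ (i + 1) = (ω i)⁻¹ := by
          have := (hω i).pow_eq_one
          rw [pow_succ] at this
          exact eq_inv_of_mul_eq_one_left this
        rw [div_pow, add_pow_char_pow, one_pow, ← pow_mul, mul_comm 2, pow_mul, hinv]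
        field_simp
        ring
      have hpow : ((ω i ^ 2 + 1) / ω i) ^ (2 * (p ^ (i + 1) + 1)) =
          (ω i ^ 2 + 1) ^ 4 / ω i ^ 4 := by
        rw [mul_comm, pow_mul, pow_succ ((ω i ^ 2 + 1) / ω i), hfix]
        ring
      rw [hpow, Ne, div_eq_one_iff_eq (pow_ne_zero _ h0)]
      exact fun h => hi2 (sub_eq_zero.2 h)
  · have : CharZero K := CharP.charP_to_charZero K
    have hn : ∀ i, ((2 * (i + 1) : ℕ) : K) ≠ 0 := fun i => Nat.cast_ne_zero.2 (by omega)
    choose ω hω using fun i => exists_primitiveRoot_of_isAlgClosed K (hn i)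
    refine ⟨fun i => 2 * (i + 1), ω, fun i => Nat.mul_ne_zero two_ne_zero (Nat.succ_ne_zero i), hω, hn, ?_,
      fun i => even_two_mul _,
      1, 2, Or.inl ⟨rfl, rfl⟩, ?_⟩
    · exact tendsto_atTop_mono (fun i => by simp only [id]; omega) tendsto_id
    · refine Filter.Eventually.of_forall fun i => ?_
      simp only [map_one, map_ofNat, div_one]
      refine ⟨one_ne_zero, two_ne_zero, ?_⟩
      have : (2 : ℕ) ^ (2 * (2 * (i + 1))) ≠ 1 := by
        simp
      exact_mod_cast this

/-! ### The polynomials defining the letters, and the twist -/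

namespace HeisenbergAlgebra

variable {k K : Type*} [Field k] [Field K] [Algebra k K]
  {n : ℕ → ℕ} [∀ i, NeZero (n i)] {ω : ℕ → K}

theorem isLetter_one_add (g : HeisenbergAlgebra k) :
    IsLetter n ω g (1 + g) (1 - g) (fun _ => 1 + X) := by
  refine ⟨fun i f _ => ⟨by simp, by simp [sub_eq_add_neg]⟩, Filter.Eventually.of_forall fun i =>
    ⟨-1, by simp, by simp, fun ζ _ h1 h => h1 ?_⟩⟩
  simp only [eval_add, eval_one, eval_X, neg_mul, one_mul] at h
  exact (add_neg_eq_zero.1 h).symm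

theorem isLetter_one_add_sq (g : HeisenbergAlgebra k) :
    IsLetter n ω g ((1 + g) ^ 2) ((1 - g) ^ 2) (fun _ => (1 + X) ^ 2) := by
  refine ⟨fun i f _ => ⟨by simp, by simp [sub_eq_add_neg]⟩, Filter.Eventually.of_forall fun i =>
    ⟨-1, by simp, by simp, fun ζ _ h1 h => h1 ?_⟩⟩
  simp only [eval_add, eval_one, eval_X, neg_mul, one_mul, eval_pow] at h
  exact (add_neg_eq_zero.1 (pow_eq_zero_iff two_ne_zero |>.1 h)).symm

theorem isLetter_linear (htop : Tendsto (fun i => orderOf (ω i)) atTop atTop)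
    (hω : ∀ i, ω i ≠ 0) (g : HeisenbergAlgebra k) :
    IsLetter n ω g (genC k + (genC k ^ 2 - 1) * g) (genC k - (genC k ^ 2 - 1) * g)
      (fun i => C (ω i) + C (ω i ^ 2 - 1) * X) := by
  refine ⟨fun i f hf => ⟨?_, ?_⟩, ?_⟩
  · simp [hf]
  · simp [hf, sub_eq_add_neg]
  · have hp : (X ^ 2 - 1 : K[X]) ≠ 0 := by
      intro h
      simpa using congrArg (fun f => f.eval 0) h
    filter_upwards [eventually_eval_ne_zero_of_tendsto_orderOf htop hp] with i hi
    simp only [eval_sub, eval_pow, eval_X, eval_one] at hi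
    have h0 := hω i
    refine ⟨-(ω i) / (ω i ^ 2 - 1), div_ne_zero (neg_ne_zero.2 h0) hi, ?_, fun ζ _ h1 h => h1 ?_⟩
    · simp only [eval_add, eval_C, eval_mul, eval_X]
      field_simp
      ring
    · simp only [eval_add, eval_C, eval_mul, eval_X] at h
      have : ω i * (1 - ζ) = 0 := by
        rw [← h]
        field_simp
        ring
      exact (sub_eq_zero.1 ((mul_eq_zero.1 this).resolve_left h0)).symm

/-- With `t = η / δ` evaluated at `ω`, the roots are `t` and `-1 / t`. If the second were `t * ζ`
with `ζ ^ n = 1`, then `t ^ 2 * ζ = -1`, and the `n`-th power with `n` even would give `t ^ (2 * n)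
= 1`. -/
theorem isLetter_quadratic (hn : ∀ i, Even (n i)) {δ η : k[X]}
    (h : ∀ᶠ i in atTop, aeval (ω i) δ ≠ 0 ∧ aeval (ω i) η ≠ 0 ∧
      (aeval (ω i) η / aeval (ω i) δ) ^ (2 * n i) ≠ 1) (g : HeisenbergAlgebra k) :
    IsLetter n ω g
      ((aeval (genC k) δ * g - aeval (genC k) η) * (aeval (genC k) η * g + aeval (genC k) δ))
      ((aeval (genC k) δ * g + aeval (genC k) η) * (aeval (genC k) η * g - aeval (genC k) δ))
      (fun i => (C (aeval (ω i) δ) * X - C (aeval (ω i) η)) *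
        (C (aeval (ω i) η) * X + C (aeval (ω i) δ))) := by
  refine ⟨fun i f hf => ?_, ?_⟩
  · have h1 : ∀ θ : k[X], f (aeval (genC k) θ) = algebraMap K _ (aeval (ω i) θ) := by
      intro θ
      rw [← aeval_algHom_apply, hf, aeval_algebraMap_apply]
    constructor
    · simp [h1]
    · simp only [map_mul, map_add, map_sub, h1, mul_comp, sub_comp, add_comp, C_comp, X_comp,
        aeval_C, map_neg, aeval_X]
      noncomm_ring
  · filter_upwards [h] with i hi
    obtain ⟨h1, h2, h3⟩ := hi
    refine ⟨aeval (ω i) η / aeval (ω i) δ, div_ne_zero h2 h1, ?_, fun ζ hζ hne h0 => ?_⟩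
    · simp only [eval_mul, eval_sub, eval_C, eval_X, eval_add]
      rw [mul_div_cancel₀ _ h1, sub_self, zero_mul]
    · simp only [eval_mul, eval_sub, eval_C, eval_X, eval_add, mul_eq_zero] at h0
      set d := aeval (ω i) δ
      set e := aeval (ω i) η
      rcases h0 with h0 | h0
      · have : e * (ζ - 1) = 0 := by
          rw [← h0]
          field_simp
        exact hne (sub_eq_zero.1 ((mul_eq_zero.1 this).resolve_left h2))
      · have h4 : (e / d) ^ 2 * ζ = -1 := by
          field_simp at h0 ⊢
          linear_combination h0
        have h5 := congrArg (· ^ n i) h4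
        simp only [mul_pow, hζ, mul_one, (hn i).neg_one_pow, ← pow_mul] at h5
        exact h3 h5

/-- The endomorphism `b ↦ (a ^ 2 - c) * b` of the Heisenberg algebra. -/
noncomputable def twist : HeisenbergAlgebra k →ₐ[k] HeisenbergAlgebra k :=
  lift (genA k) ((genA k ^ 2 - genC k) * genB k) (genC k)
    (by
      have h1 : genA k * (genA k ^ 2 - genC k) = (genA k ^ 2 - genC k) * genA k := by
        rw [mul_sub, sub_mul, (commute_genC_genA (k := k)).eq, ← pow_succ, ← pow_succ']
      have h2 : Commute (genC k) (genA k ^ 2 - genC k) :=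
        (commute_genC_genA.pow_right 2).sub_right (Commute.refl _)
      rw [← mul_assoc, h1, mul_assoc, genA_mul_genB, ← mul_assoc, ← mul_assoc, ← h2.eq,
        ← mul_assoc])
    commute_genC_genA
    (((commute_genC_genA.pow_right 2).sub_right (Commute.refl _)).mul_right commute_genC_genB)

/-- Composing the clock and shift representation with the twist keeps the weights, since at `X = 0`
the factor `a ^ 2 - c` becomes the invertible scalar `-ω`. So a nonzero element cannot be killed. -/
theorem twist_injective (hω : ∀ i, IsPrimitiveRoot (ω i) (n i)) (hn : ∀ i, (n i : K) ≠ 0)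
    (htop : Tendsto n atTop atTop) : Function.Injective (twist (k := k)) := by
  rw [injective_iff_map_eq_zero]
  intro r hr
  by_contra hne
  have hord : ∀ i, orderOf (ω i) = n i := fun i => (hω i).eq_orderOf.symm
  have hev : ∀ (i : ℕ) (Q : Matrix (ZMod (n i)) (ZMod (n i)) K[X]),
      Q.det.eval 0 = ((evalRingHom (0 : K)).mapMatrix Q).det := by
    intro i Q
    rw [← RingHom.map_det]
    rfl
  have hC : ∀ (i : ℕ) (Q : Matrix (ZMod (n i)) (ZMod (n i)) K),
      (evalRingHom (0 : K)).mapMatrix (C.mapMatrix Q) = Q := by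
    intro i Q
    ext a b
    simp
  have := eventually_det_ne_zero (l := atTop)
    (fun i => (clockShift (hω i) (hn i) 1 1).comp (twist (k := k))) (ω := ω)
    (A := fun i => C.mapMatrix ((1 : K) • clockMatrix (hω i)))
    (B := fun i => (((X : K[X]) • C.mapMatrix ((1 : K) • clockMatrix (hω i))) ^ 2 -
      algebraMap K _ (ω i)) * C.mapMatrix ((1 : K) • shiftMatrix (hω i)))
    (by simpa only [hord] using htop)
    (fun i => by simp [twist, clockShift_genC])
    (fun i => by simp only [AlgHom.comp_apply, twist, lift_genA, clockShift_genA])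
    (fun i => by
      simp only [AlgHom.comp_apply, twist, lift_genB, map_mul, map_sub, map_pow, clockShift_genA,
        clockShift_genB, clockShift_genC, hord, mul_smul_comm])
    (fun i => by
      rw [hev, hC, one_smul]
      exact det_clockMatrix_ne_zero _)
    (fun i => by
      have h0 : (evalRingHom (0 : K)).mapMatrix
          ((X : K[X]) • C.mapMatrix ((1 : K) • clockMatrix (hω i))) = 0 := by
        ext a b
        simp
      have h1 : (evalRingHom (0 : K)).mapMatrix
          (algebraMap K (Matrix (ZMod (n i)) (ZMod (n i)) K[X]) (ω i)) = ω i • 1 := by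
        ext a b
        by_cases hab : a = b <;> simp [hab, Matrix.algebraMap_matrix_apply]
      rw [hev, map_mul, map_sub, map_pow, h0, h1, hC, one_smul, zero_pow two_ne_zero, zero_sub,
        ← neg_smul, smul_mul_assoc, one_mul, Matrix.det_smul]
      exact mul_ne_zero (pow_ne_zero _ (neg_ne_zero.2 ((hω i).ne_zero (NeZero.ne _))))
        (det_shiftMatrix_ne_zero _ (hn i))) hne
  obtain ⟨i, hi⟩ := this.exists
  rw [AlgHom.comp_apply, hr, map_zero] at hi
  exact hi Matrix.det_zero

end HeisenbergAlgebra

/-! ### Symmetry and unitarity of the fractions -/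

section Star

variable {D : Type*} [DivisionRing D] [StarRing D]

/-- The involution multiplies numerator and denominator by the same factor `e`, which cancels in the
fraction. -/
theorem isSelfAdjoint_of_mul_eq {u : Dˣ} {p q e : D} (hu : u * q = p) (hq : q ≠ 0) (he : e ≠ 0)
    (hpq : Commute p q) (hp : star p = e * p) (hq' : star q = e * q) :
    IsSelfAdjoint (u : D) := by
  have h1 : q * star (u : D) = p := by
    have := congrArg star hu
    rw [star_mul, hp, hq', mul_assoc] at this
    exact mul_left_cancel₀ he this
  have h2 : q * (u : D) = p := by
    apply mul_right_cancel₀ hq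
    rw [mul_assoc, hu, hpq.eq]
  exact mul_left_cancel₀ hq (h1.trans h2.symm)

/-- The involution swaps numerator and denominator up to the common factor `e`, so it inverts the
fraction. -/
theorem mem_unitary_of_mul_eq {u : Dˣ} {p q e : D} (hu : u * q = p) (hq : q ≠ 0) (he : e ≠ 0)
    (hpq : Commute p q) (hp : star p = e * q) (hq' : star q = e * p) :
    (u : D) ∈ unitary D := by
  have hp0 : p ≠ 0 := hu ▸ mul_ne_zero u.ne_zero hq
  have h1 : p * star (u : D) = q := by
    have := congrArg star hu
    rw [star_mul, hp, hq', mul_assoc] at this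
    exact mul_left_cancel₀ he this
  have h2 : star (u : D) * u = 1 := by
    apply mul_right_cancel₀ hq
    apply mul_left_cancel₀ hp0
    rw [mul_assoc, hu, one_mul, ← mul_assoc, h1, hpq.eq]
  rw [Unitary.mem_iff]
  exact ⟨h2, mul_eq_one_comm.1 h2⟩

/-- Replacing `g` by `g⁻¹` changes the sign of `(1 + g) * (1 - g)⁻¹`, and squaring removes the sign.
-/
theorem isSelfAdjoint_of_one_add_sq {u : Dˣ} {g : D} (hg0 : g ≠ 0)
    (hg : star g = g ∨ star g = g⁻¹) (hu : u * (1 - g) ^ 2 = (1 + g) ^ 2)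
    (hq : (1 - g) ^ 2 ≠ 0) : IsSelfAdjoint (u : D) := by
  have hc : Commute (1 + g) (1 - g) :=
    ((Commute.one_left _).add_left ((Commute.one_right g).sub_right (Commute.refl g)))
  rcases hg with hg | hg
  · exact isSelfAdjoint_of_mul_eq (e := 1) hu hq one_ne_zero (hc.pow_pow 2 2)
      (by simp [hg]) (by simp [hg])
  · have h1 : Commute g⁻¹ (1 + g) :=
      (Commute.one_right _).add_right (Commute.refl g).inv_left₀
    have h2 : Commute g⁻¹ (1 - g) :=
      (Commute.one_right _).sub_right (Commute.refl g).inv_left₀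
    refine isSelfAdjoint_of_mul_eq (e := g⁻¹ ^ 2) hu hq (pow_ne_zero _ (inv_ne_zero hg0))
      (hc.pow_pow 2 2) ?_ ?_
    · rw [← h1.mul_pow, mul_add, mul_one, inv_mul_cancel₀ hg0]
      simp [hg, add_comm]
    · rw [← h2.mul_pow, mul_sub, mul_one, inv_mul_cancel₀ hg0, ← neg_sub, neg_sq]
      simp [hg]

theorem mem_unitary_of_one_add {u : Dˣ} {g : D} (hg : star g = -g)
    (hu : u * (1 - g) = 1 + g) (hq : 1 - g ≠ 0) : (u : D) ∈ unitary D :=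
  mem_unitary_of_mul_eq (e := 1) hu hq one_ne_zero
    ((Commute.one_left _).add_left ((Commute.one_right g).sub_right (Commute.refl g)))
    (by simp [hg, sub_eq_add_neg]) (by simp [hg])

/-- After cancelling `c`, this is the Cayley transform of the skew element `(c - c⁻¹) * g`. The form
used avoids `c⁻¹`, which the Heisenberg algebra does not contain. -/
theorem mem_unitary_of_linear {u : Dˣ} {c g : D} (hc0 : c ≠ 0) (hcg : Commute c g)
    (hg : star g = g) (hc : star c = c⁻¹)
    (hu : u * (c - (c ^ 2 - 1) * g) = c + (c ^ 2 - 1) * g) (hq : c - (c ^ 2 - 1) * g ≠ 0) :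
    (u : D) ∈ unitary D := by
  have h1 : Commute (c ^ 2 - 1) g := (hcg.pow_left 2).sub_left (Commute.one_left g)
  have h2 : Commute c (c ^ 2 - 1) :=
    ((Commute.refl c).pow_right 2).sub_right (Commute.one_right c)
  have h3 : Commute c ((c ^ 2 - 1) * g) := h2.mul_right hcg
  have h4 : star ((c ^ 2 - 1) * g) = -(c⁻¹ ^ 2 * ((c ^ 2 - 1) * g)) := by
    have h6 : c⁻¹ ^ 2 * (c ^ 2 - 1) = 1 - c⁻¹ ^ 2 := by
      rw [mul_sub, mul_one, inv_pow, inv_mul_cancel₀ (pow_ne_zero 2 hc0)]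
    rw [star_mul, hg, star_sub, star_pow, hc, star_one, ← mul_assoc, h6, ← neg_mul, neg_sub,
      mul_sub, sub_mul, (hcg.inv_left₀.pow_left 2).eq, mul_one, one_mul]
  have h5 : c⁻¹ = c⁻¹ ^ 2 * c := by
    rw [pow_two, mul_assoc, inv_mul_cancel₀ hc0, mul_one]
  refine mem_unitary_of_mul_eq (e := c⁻¹ ^ 2) hu hq (pow_ne_zero _ (inv_ne_zero hc0)) ?_ ?_ ?_
  · exact ((Commute.refl c).sub_right h3).add_left
      (h3.symm.sub_right (Commute.refl _))
  · rw [star_add, h4, hc, mul_sub, ← h5, ← sub_eq_add_neg]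
  · rw [star_sub, h4, hc, mul_add, ← h5, sub_neg_eq_add]

/-- Inverting `g` turns `d * g - h` into `-(h * g - d)` and `h * g + d` into `d * g + h`, each up to
the factor `e * g⁻¹`. So numerator and denominator are swapped up to `-(e * g⁻¹) ^ 2`. -/
theorem mem_unitary_of_quadratic {u : Dˣ} {g d h e : D} (hg0 : g ≠ 0) (he0 : e ≠ 0)
    (hdg : Commute d g) (hhg : Commute h g) (hdh : Commute d h) (heg : Commute e g)
    (hed : Commute e d) (heh : Commute e h)
    (hg : star g = g⁻¹) (hd : star d = e * d) (hh : star h = e * h)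
    (hu : u * ((d * g + h) * (h * g - d)) = (d * g - h) * (h * g + d))
    (hq : (d * g + h) * (h * g - d) ≠ 0) : (u : D) ∈ unitary D := by
  have hdg' := hdg.inv_right₀
  have hhg' := hhg.inv_right₀
  have heg' := heg.inv_right₀
  have hgg : g⁻¹ * g = 1 := inv_mul_cancel₀ hg0
  have key : ∀ x y : D, Commute x g⁻¹ → Commute y g⁻¹ → Commute e x → Commute e y →
      g⁻¹ * (e * x) + e * y = e * g⁻¹ * (x + y * g) := by
    intro x y hx hy hex hey
    rw [mul_add, mul_assoc e, mul_assoc e, ← mul_assoc g⁻¹ y, ← hy.eq, mul_assoc y, hgg, mul_one,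
      ← mul_assoc, ← mul_assoc, heg'.eq]
  have hdgh : Commute (d * g) (h * g) :=
    ((hdh.mul_right hdg).mul_left (hhg.symm.mul_right (Commute.refl g)))
  have hdg_d : Commute (d * g) d := (Commute.refl d).mul_left hdg.symm
  have hhg_h : Commute (h * g) h := (Commute.refl h).mul_left hhg.symm
  have hdg_h : Commute (d * g) h := hdh.mul_left hhg.symm
  have hhg_d : Commute (h * g) d := hdh.symm.mul_left hdg.symm
  have hsd : Commute (e * g⁻¹) d := hed.mul_left hdg'.symm
  have hsh : Commute (e * g⁻¹) h := heh.mul_left hhg'.symm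
  have hsg : Commute (e * g⁻¹) g := heg.mul_left (Commute.refl g).inv_left₀
  have hmove : ∀ x y : D, Commute (e * g⁻¹) x →
      (e * g⁻¹ * x) * (e * g⁻¹ * y) = (e * g⁻¹) ^ 2 * (x * y) := by
    intro x y hx
    rw [pow_two, mul_assoc (e * g⁻¹) x, ← mul_assoc x, ← hx.eq]
    simp only [mul_assoc]
  refine mem_unitary_of_mul_eq (e := -(e * g⁻¹) ^ 2) hu hq
    (neg_ne_zero.2 (pow_ne_zero _ (mul_ne_zero he0 (inv_ne_zero hg0)))) ?_ ?_ ?_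
  · have a1 : Commute (d * g) (d * g + h) := (Commute.refl _).add_right hdg_h
    have a2 : Commute (d * g) (h * g - d) := hdgh.sub_right hdg_d
    have a3 : Commute h (d * g + h) := hdg_h.symm.add_right (Commute.refl _)
    have a4 : Commute h (h * g - d) := hhg_h.symm.sub_right hdh.symm
    have a5 : Commute (h * g) (d * g + h) := hdgh.symm.add_right hhg_h
    have a6 : Commute (h * g) (h * g - d) := (Commute.refl _).sub_right hhg_d
    have a7 : Commute d (d * g + h) := hdg_d.symm.add_right hdh
    have a8 : Commute d (h * g - d) := hhg_d.symm.sub_right (Commute.refl _)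
    exact ((a1.sub_left a3).mul_right (a2.sub_left a4)).mul_left
      ((a5.add_left a7).mul_right (a6.add_left a8))
  · have h1 := key h d hhg' hdg' heh hed
    have h2 := key d (-h) hdg' hhg'.neg_left hed heh.neg_right
    rw [star_mul, star_add, star_sub, star_mul, star_mul, hg, hd, hh, h1, sub_eq_add_neg,
      ← mul_neg, h2, hmove _ _ (hsh.add_right (hsd.mul_right hsg))]
    noncomm_ring
  · have h1 := key h (-d) hhg' hdg'.neg_left heh hed.neg_right
    have h2 := key d h hdg' hhg' hed heh
    rw [star_mul, star_add, star_sub, star_mul, star_mul, hg, hd, hh, h2, sub_eq_add_neg,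
      ← mul_neg, h1, hmove _ _ (hsh.add_right (hsd.neg_right.mul_right hsg))]
    noncomm_ring

theorem star_twist_eq_neg {a b c : D} (ha0 : a ≠ 0) (hab : a * b = c * b * a) (hca : Commute c a)
    (hcb : Commute c b) (ha : star a = a⁻¹) (hb : star b = b) (hc : star c = c) :
    star ((a ^ 2 - c) * (a⁻¹ * b)) = -((a ^ 2 - c) * (a⁻¹ * b)) := by
  have h1 : b * a⁻¹ = c * (a⁻¹ * b) := by
    apply mul_right_cancel₀ ha0
    apply mul_left_cancel₀ ha0
    rw [inv_mul_cancel_right₀ ha0, hab]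
    have : a * (c * (a⁻¹ * b) * a) = c * (a * a⁻¹) * b * a := by
      rw [← mul_assoc, ← mul_assoc, ← hca.eq]; simp only [mul_assoc]
    rw [this, mul_inv_cancel₀ ha0, mul_one]
  have h2 : b * a * c = a * b := by
    rw [hab, mul_assoc, ← hca.eq, ← mul_assoc, ← hcb.eq]
  have h3 : star ((a ^ 2 - c) * (a⁻¹ * b)) = b * a⁻¹ - b * a * c := by
    rw [star_mul, star_mul, star_sub, star_pow, star_inv₀, ha, hb, hc, inv_inv, mul_sub, mul_assoc b a,
      pow_two, mul_inv_cancel_left₀ ha0]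
  rw [h3, h1, h2, sub_mul, pow_two, mul_assoc a a, mul_inv_cancel_left₀ ha0, neg_sub]

end Star

/-! ### Embedding the Heisenberg algebra and producing the pairs -/

theorem HeisenbergMonoid.lift_injective {G : Type*} [Group G] {a b c : G}
    (hab : a * b = c * b * a) (hca : Commute c a) (hcb : Commute c b) (hc : ¬ IsOfFinOrder c) :
    Function.Injective (HeisenbergMonoid.lift a b c hab hca hcb) := by
  set φ := HeisenbergMonoid.lift a b c hab hca hcb
  have hpow : Function.Injective fun n : ℕ => c ^ n := injective_pow_iff_not_isOfFinOrder.2 hc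
  have hφc : ∀ n, φ ⟨n, 0, 0⟩ = c ^ n := fun n => by simp [φ, lift_apply]
  -- Commuting a monomial with `a` reads off its exponent of `b` as a power of `c`, and commuting it
  -- with `b` reads off its exponent of `a`. These exponents are determined because `c` has infinite
  -- order.
  have hA : ∀ x, φ ⟨0, 0, 1⟩ * φ x = c ^ x.b * φ x * φ ⟨0, 0, 1⟩ := by
    intro x
    rw [← hφc, ← map_mul, ← map_mul, ← map_mul]
    congr 1
    simp [mul_def, add_comm]
  have hB : ∀ x, φ x * φ ⟨0, 1, 0⟩ = c ^ x.a * φ ⟨0, 1, 0⟩ * φ x := by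
    intro x
    rw [← hφc, ← map_mul, ← map_mul, ← map_mul]
    congr 1
    simp [mul_def]
    exact ⟨add_comm _ _, add_comm _ _⟩
  intro x y hxy
  have hb : x.b = y.b := by
    have h := hA x
    rw [hxy, hA y] at h
    exact (hpow (mul_right_cancel (mul_right_cancel h))).symm
  have ha : x.a = y.a := by
    have h := hB x
    rw [hxy, hB y] at h
    exact (hpow (mul_right_cancel (mul_right_cancel h))).symm
  refine HeisenbergMonoid.ext (hpow ?_) hb ha
  have h : c ^ x.c * b ^ x.b * a ^ x.a = c ^ y.c * b ^ y.b * a ^ y.a := hxy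
  rw [hb, ha] at h
  exact mul_right_cancel (mul_right_cancel h)

namespace HeisenbergAlgebra

theorem exists_injective_algHom {k G D : Type*} [Field k] [Group G] [DivisionRing D] [Algebra k D]
    (ι : MonoidAlgebra k G →ₐ[k] D) (hι : Function.Injective ι) {a b c : G}
    (hab : a * b = c * b * a) (hca : Commute c a) (hcb : Commute c b) (hc : ¬ IsOfFinOrder c) :
    ∃ ψ : HeisenbergAlgebra k →ₐ[k] D, Function.Injective ψ ∧
      ψ (genA k) = ι (MonoidAlgebra.of k G a) ∧ ψ (genB k) = ι (MonoidAlgebra.of k G b) ∧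
      ψ (genC k) = ι (MonoidAlgebra.of k G c) := by
  refine ⟨ι.comp (MonoidAlgebra.mapDomainAlgHom k k (HeisenbergMonoid.lift a b c hab hca hcb)),
    hι.comp (MonoidAlgebra.mapDomain_injective
      (HeisenbergMonoid.lift_injective hab hca hcb hc)), ?_, ?_, ?_⟩
  · simp [genA, HeisenbergMonoid.lift_apply]
  · simp [genB, HeisenbergMonoid.lift_apply]
  · simp [genC, HeisenbergMonoid.lift_apply]

section Pairs

variable {k D : Type*} [Field k] [DivisionRing D] [Algebra k D] [StarRing D]

theorem exists_isFreeSymmetricPair (hk : ringChar k ≠ 2) (ψ : HeisenbergAlgebra k →ₐ[k] D)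
    (hψ : Function.Injective ψ) (ha0 : ψ (genA k) ≠ 0) (hb0 : ψ (genB k) ≠ 0)
    (ha : star (ψ (genA k)) = ψ (genA k) ∨ star (ψ (genA k)) = (ψ (genA k))⁻¹)
    (hb : star (ψ (genB k)) = ψ (genB k) ∨ star (ψ (genB k)) = (ψ (genB k))⁻¹) :
    ∃ u v : Dˣ, IsFreeSymmetricPair u v := by
  obtain ⟨n, ω, hn0, hω, hn, htop, hn2, -⟩ := exists_rootSequence k (AlgebraicClosure k) hk
  have : ∀ i, NeZero (n i) := fun i => ⟨hn0 i⟩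
  obtain ⟨u, v, hu, hv, hqu, hqv, hfree⟩ := exists_isFreePair hω hn htop hn2 ψ hψ
    (isLetter_one_add_sq (genA k)) (isLetter_one_add_sq (genB k))
  simp only [map_pow, map_sub, map_add, map_one] at hu hv hqu hqv
  exact ⟨u, v, isSelfAdjoint_of_one_add_sq ha0 ha hu hqu,
    isSelfAdjoint_of_one_add_sq hb0 hb hv hqv, hfree⟩

theorem exists_isFreeUnitaryPair_of_symmetric (hk : ringChar k ≠ 2)
    (ψ : HeisenbergAlgebra k →ₐ[k] D) (hψ : Function.Injective ψ) (hc0 : ψ (genC k) ≠ 0)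
    (ha : star (ψ (genA k)) = ψ (genA k)) (hb : star (ψ (genB k)) = ψ (genB k))
    (hc : star (ψ (genC k)) = (ψ (genC k))⁻¹) : ∃ u v : Dˣ, IsFreeUnitaryPair u v := by
  obtain ⟨n, ω, hn0, hω, hn, htop, hn2, -⟩ := exists_rootSequence k (AlgebraicClosure k) hk
  have : ∀ i, NeZero (n i) := fun i => ⟨hn0 i⟩
  have hord : Tendsto (fun i => orderOf (ω i)) atTop atTop := by
    simpa only [← (hω _).eq_orderOf] using htop
  have hω0 : ∀ i, ω i ≠ 0 := fun i => (hω i).ne_zero (hn0 i)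
  obtain ⟨u, v, hu, hv, hqu, hqv, hfree⟩ := exists_isFreePair hω hn htop hn2 ψ hψ
    (isLetter_linear hord hω0 (genA k)) (isLetter_linear hord hω0 (genB k))
  simp only [map_pow, map_sub, map_add, map_one, map_mul] at hu hv hqu hqv
  exact ⟨u, v, mem_unitary_of_linear hc0 (commute_genC_genA.map ψ) ha hc hu hqu,
    mem_unitary_of_linear hc0 (commute_genC_genB.map ψ) hb hc hv hqv, hfree⟩

/-- The fractions of `isLetter_quadratic` are unitary. -/
theorem mem_unitary_of_isLetter_quadratic (ψ : HeisenbergAlgebra k →ₐ[k] D) {δ η : k[X]}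
    (hδη : (δ = 1 ∧ η = 2) ∨ (δ = X ∧ η = X ^ 2 + 1)) {g : HeisenbergAlgebra k}
    (hcg : Commute (genC k) g) (hg0 : ψ g ≠ 0) (hc0 : ψ (genC k) ≠ 0)
    (hg : star (ψ g) = (ψ g)⁻¹)
    (hc : star (ψ (genC k)) = ψ (genC k) ∨ star (ψ (genC k)) = (ψ (genC k))⁻¹) {u : Dˣ}
    (hu : u * ψ ((aeval (genC k) δ * g + aeval (genC k) η) *
        (aeval (genC k) η * g - aeval (genC k) δ)) =
      ψ ((aeval (genC k) δ * g - aeval (genC k) η) *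
        (aeval (genC k) η * g + aeval (genC k) δ)))
    (hq : ψ ((aeval (genC k) δ * g + aeval (genC k) η) *
        (aeval (genC k) η * g - aeval (genC k) δ)) ≠ 0) : (u : D) ∈ unitary D := by
  have hcg' : Commute (ψ (genC k)) (ψ g) := hcg.map ψ
  set c := ψ (genC k)
  have hδ : ψ (aeval (genC k) δ) = aeval c δ := (aeval_algHom_apply ψ (genC k) δ).symm
  have hη : ψ (aeval (genC k) η) = aeval c η := (aeval_algHom_apply ψ (genC k) η).symm
  simp only [map_mul, map_add, map_sub, hδ, hη] at hu hq
  have hcomm : ∀ {x : D} (θ : k[X]), Commute c x → Commute (aeval c θ) x := by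
    intro x θ h
    induction θ using Polynomial.induction_on' with
    | add p q hp hq => rw [map_add]; exact hp.add_left hq
    | monomial m z =>
      rw [aeval_monomial]
      exact Commute.mul_left (Algebra.commutes z x) (h.pow_left m)
  have hcc : ∀ θ θ' : k[X], Commute (aeval c θ) (aeval c θ') := fun θ θ' =>
    hcomm θ (hcomm θ' (Commute.refl c)).symm
  obtain ⟨e, he0, he, hstar⟩ : ∃ e : D, e ≠ 0 ∧ (∀ x, Commute c x → Commute e x) ∧
      star (aeval c δ) = e * aeval c δ ∧ star (aeval c η) = e * aeval c η := by
    rcases hδη with ⟨rfl, rfl⟩ | ⟨rfl, rfl⟩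
    · exact ⟨1, one_ne_zero, fun x _ => Commute.one_left x, by simp, by
        rw [map_ofNat, one_mul]; exact star_ofNat 2⟩
    · rcases hc with hc | hc
      · exact ⟨1, one_ne_zero, fun x _ => Commute.one_left x, by simp [hc], by simp [hc]⟩
      -- Inverting `c` multiplies both `c` and `c ^ 2 + 1` by `c⁻¹ ^ 2`, so their quotient `c + c⁻¹`
      -- is symmetric.
      · refine ⟨c⁻¹ ^ 2, pow_ne_zero _ (inv_ne_zero hc0),
          fun x hx => hx.inv_left₀.pow_left 2, ?_, ?_⟩
        · rw [aeval_X, hc, pow_two, mul_assoc, inv_mul_cancel₀ hc0, mul_one]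
        · simp only [map_add, map_pow, aeval_X, map_one, star_add, star_pow, hc, star_one, mul_add,
            mul_one]
          rw [inv_pow, inv_mul_cancel₀ (pow_ne_zero 2 hc0), add_comm]
  exact mem_unitary_of_quadratic hg0 he0 (hcomm δ hcg') (hcomm η hcg') (hcc δ η) (he _ hcg')
    (he _ (hcomm δ (Commute.refl c)).symm) (he _ (hcomm η (Commute.refl c)).symm) hg
    hstar.1 hstar.2 hu hq

theorem exists_isFreeUnitaryPair_of_unitary (hk : ringChar k ≠ 2)
    (ψ : HeisenbergAlgebra k →ₐ[k] D) (hψ : Function.Injective ψ) (ha0 : ψ (genA k) ≠ 0)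
    (hb0 : ψ (genB k) ≠ 0) (hc0 : ψ (genC k) ≠ 0)
    (ha : star (ψ (genA k)) = (ψ (genA k))⁻¹) (hb : star (ψ (genB k)) = (ψ (genB k))⁻¹)
    (hc : star (ψ (genC k)) = (ψ (genC k))⁻¹) : ∃ u v : Dˣ, IsFreeUnitaryPair u v := by
  obtain ⟨n, ω, hn0, hω, hn, htop, hn2, δ, η, hδη, hev⟩ :=
    exists_rootSequence k (AlgebraicClosure k) hk
  have : ∀ i, NeZero (n i) := fun i => ⟨hn0 i⟩
  obtain ⟨u, v, hu, hv, hqu, hqv, hfree⟩ := exists_isFreePair hω hn htop hn2 ψ hψ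
    (isLetter_quadratic hn2 hev (genA k)) (isLetter_quadratic hn2 hev (genB k))
  exact ⟨u, v,
    mem_unitary_of_isLetter_quadratic ψ hδη commute_genC_genA ha0 hc0 ha (Or.inr hc) hu hqu,
    mem_unitary_of_isLetter_quadratic ψ hδη commute_genC_genB hb0 hc0 hb (Or.inr hc) hv hqv, hfree⟩

/-- Here `ψ (genB k)` is `a⁻¹ * b` for a symmetric element `b`. -/
theorem exists_isFreeUnitaryPair_of_mixed (hk : ringChar k ≠ 2)
    (ψ : HeisenbergAlgebra k →ₐ[k] D) (hψ : Function.Injective ψ) (ha0 : ψ (genA k) ≠ 0)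
    (hc0 : ψ (genC k) ≠ 0) {b : D} (hab : ψ (genA k) * b = ψ (genC k) * b * ψ (genA k))
    (hcb : Commute (ψ (genC k)) b) (hψb : ψ (genB k) = (ψ (genA k))⁻¹ * b)
    (ha : star (ψ (genA k)) = (ψ (genA k))⁻¹) (hb : star b = b)
    (hc : star (ψ (genC k)) = ψ (genC k)) : ∃ u v : Dˣ, IsFreeUnitaryPair u v := by
  obtain ⟨n, ω, hn0, hω, hn, htop, hn2, δ, η, hδη, hev⟩ :=
    exists_rootSequence k (AlgebraicClosure k) hk
  have : ∀ i, NeZero (n i) := fun i => ⟨hn0 i⟩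
  have hA : (ψ.comp twist) (genA k) = ψ (genA k) := by simp [twist]
  have hC : (ψ.comp twist) (genC k) = ψ (genC k) := by simp [twist]
  have hB : (ψ.comp twist) (genB k) =
      (ψ (genA k) ^ 2 - ψ (genC k)) * ((ψ (genA k))⁻¹ * b) := by
    simp [twist, hψb]
  obtain ⟨u, v, hu, hv, hqu, hqv, hfree⟩ := exists_isFreePair hω hn htop hn2 (ψ.comp twist)
    (hψ.comp (twist_injective hω hn htop)) (isLetter_quadratic hn2 hev (genA k))
    (isLetter_one_add (genB k))
  refine ⟨u, v, mem_unitary_of_isLetter_quadratic _ hδη commute_genC_genA (by rwa [hA])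
    (by rwa [hC]) (by rwa [hA]) (Or.inl (by rwa [hC])) hu hqu, ?_, hfree⟩
  refine mem_unitary_of_one_add (g := (ψ.comp twist) (genB k)) ?_ (by simpa using hv)
    (by simpa using hqv)
  rw [hB]
  exact star_twist_eq_neg ha0 hab (commute_genC_genA.map ψ) hcb ha hb hc

end Pairs

end HeisenbergAlgebra

/-! ### The cases according to the action on `a` and `b` -/

open HeisenbergAlgebra

theorem exists_isFreeUnitaryPair_of_inv_of_self {k G D : Type*} [Field k] (hk : ringChar k ≠ 2)
    [Group G] [DivisionRing D] [Algebra k D] (ι : MonoidAlgebra k G →ₐ[k] D)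
    (hι : Function.Injective ι) [StarMul G] [StarRing D]
    (hind : ∀ g : G, star (ι (MonoidAlgebra.of k G g)) = ι (MonoidAlgebra.of k G (star g)))
    {a b c : G} (hab : a * b = c * b * a) (hcen : ∀ g, c * g = g * c) (hc : ¬ IsOfFinOrder c)
    (ha : star a = a⁻¹) (hb : star b = b) : ∃ u v : Dˣ, IsFreeUnitaryPair u v := by
  let j : G →* D := (ι : MonoidAlgebra k G →* D).comp (MonoidAlgebra.of k G)
  have hj0 : ∀ g, j g ≠ 0 := fun g h => by
    have h1 : j g * j g⁻¹ = 1 := by rw [← map_mul, mul_inv_cancel, map_one]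
    rw [h, zero_mul] at h1
    exact zero_ne_one h1
  have hjinv : ∀ g, j g⁻¹ = (j g)⁻¹ := fun g =>
    eq_inv_of_mul_eq_one_left (by rw [← map_mul, inv_mul_cancel, map_one])
  have hsc : star c = c := by
    have h := congrArg star hab
    rw [star_mul, star_mul, star_mul, ha, hb] at h
    have h1 : a⁻¹ * b * star c = a⁻¹ * b * c := by
      rw [mul_assoc, ← h, mul_assoc, ← hcen b]
      apply mul_left_cancel (a := a)
      apply mul_right_cancel (b := a)
      calc a * (b * a⁻¹) * a = a * b := by group
        _ = a * (a⁻¹ * (c * b)) * a := by rw [hab]; group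
    exact mul_left_cancel h1
  -- The second generator is `a⁻¹ * b` rather than `b`, so that the skew element `(a ^ 2 - c) * a⁻¹
  -- * b` is the image of a generator under `twist`, with no inverse of `a`.
  have hab' : a * (a⁻¹ * b) = c * (a⁻¹ * b) * a := by
    rw [← mul_assoc c, hcen a⁻¹, mul_assoc a⁻¹ c, mul_assoc a⁻¹, ← hab,
      mul_inv_cancel_left, inv_mul_cancel_left]
  obtain ⟨ψ, hψ, hA, hB, hC⟩ := exists_injective_algHom ι hι hab' (hcen a) (hcen _) hc
  change _ = j a at hA
  change _ = j (a⁻¹ * b) at hB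
  change _ = j c at hC
  refine exists_isFreeUnitaryPair_of_mixed hk ψ hψ (b := j b) ?_ ?_ ?_ ?_ ?_ ?_ ?_ ?_
  · rw [hA]; exact hj0 a
  · rw [hC]; exact hj0 c
  · rw [hA, hC, ← map_mul, hab, map_mul, map_mul]
  · rw [hC]; exact (show Commute c b from hcen b).map j
  · rw [hA, hB, map_mul, hjinv]
  · rw [hA]; exact (hind a).trans (by rw [ha]; exact hjinv a)
  · exact (hind b).trans (by rw [hb]; rfl)
  · rw [hC]; exact (hind c).trans (by rw [hsc]; rfl)

theorem theoremT {k G D : Type*} [Field k] (hk : ringChar k ≠ 2)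
    [Group G] [Group.IsNilpotent G] (htf : ∀ g : G, g ≠ 1 → ¬ IsOfFinOrder g)
    (hna : ∃ a b : G, a * b ≠ b * a)
    [DivisionRing D] [Algebra k D]
    (ι : MonoidAlgebra k G →ₐ[k] D) (hι : IsDivisionRingOfFractions (ι : MonoidAlgebra k G →+* D))
    -- the involution of `G`
    [StarMul G]
    -- the `k`-involution on `D`, which extends the involution of `G`
    [StarRing D] (hlin : ∀ (c : k) (x : D), star (c • x) = c • star x)
    (hind : ∀ g : G, star (ι (MonoidAlgebra.of k G g)) = ι (MonoidAlgebra.of k G (star g))) :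
    (∃ u v : Dˣ, IsFreeSymmetricPair u v) ∧ (∃ u v : Dˣ, IsFreeUnitaryPair u v) := by
  obtain ⟨a, b, c, hab, hcen, hc1, ha, hb⟩ := exists_heisenberg_pair htf hna
  have hinj : Function.Injective ι := hι.injective
  have hc := htf c hc1
  let j : G →* D := (ι : MonoidAlgebra k G →* D).comp (MonoidAlgebra.of k G)
  have hj0 : ∀ g, j g ≠ 0 := fun g h => by
    have h1 : j g * j g⁻¹ = 1 := by rw [← map_mul, mul_inv_cancel, map_one]
    rw [h, zero_mul] at h1
    exact zero_ne_one h1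
  have hjinv : ∀ g, j g⁻¹ = (j g)⁻¹ := fun g =>
    eq_inv_of_mul_eq_one_left (by rw [← map_mul, inv_mul_cancel, map_one])
  have hself : ∀ {g}, star g = g → star (j g) = j g := fun {g} h =>
    (hind g).trans (by rw [h]; rfl)
  have hinv : ∀ {g}, star g = g⁻¹ → star (j g) = (j g)⁻¹ := fun {g} h =>
    (hind g).trans (by rw [h]; exact hjinv g)
  have hba : b * a = c⁻¹ * a * b := by rw [mul_assoc, hab]; group
  have hcen' : ∀ g, c⁻¹ * g = g * c⁻¹ := fun g => by
    have h := hcen (c⁻¹ * g * c⁻¹)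
    calc c⁻¹ * g = (c⁻¹ * g * c⁻¹) * c := by group
      _ = g * c⁻¹ := by rw [← h]; group
  have hstar : star b * star a = star a * star b * star c := by
    have h := congrArg star hab
    rwa [star_mul, star_mul, star_mul, ← mul_assoc] at h
  obtain ⟨ψ, hψ, hA, hB, hC⟩ := exists_injective_algHom ι hinj hab (hcen a) (hcen b) hc
  change _ = j a at hA
  change _ = j b at hB
  change _ = j c at hC
  have ha0 : ψ (genA k) ≠ 0 := hA ▸ hj0 a
  have hb0 : ψ (genB k) ≠ 0 := hB ▸ hj0 b
  have hc0 : ψ (genC k) ≠ 0 := hC ▸ hj0 c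
  constructor
  · refine exists_isFreeSymmetricPair hk ψ hψ ha0 hb0 ?_ ?_
    · rw [hA]; exact ha.imp hself hinv
    · rw [hB]; exact hb.imp hself hinv
  · rcases ha with ha | ha <;> rcases hb with hb | hb
    · have hsc : star c = c⁻¹ := by
        rw [ha, hb, hba, mul_assoc, hcen'] at hstar
        exact (mul_left_cancel hstar).symm
      exact exists_isFreeUnitaryPair_of_symmetric hk ψ hψ hc0 (by rw [hA]; exact hself ha)
        (by rw [hB]; exact hself hb) (by rw [hC]; exact hinv hsc)
    -- Exchanging the roles of `a` and `b` replaces `c` by `c⁻¹`.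
    · exact exists_isFreeUnitaryPair_of_inv_of_self hk ι hinj hind hba hcen'
        (fun h => hc (by simpa using h.inv)) hb ha
    · exact exists_isFreeUnitaryPair_of_inv_of_self hk ι hinj hind hab hcen hc ha hb
    · have hsc : star c = c⁻¹ := by
        have h1 : star c = b * a * (b⁻¹ * a⁻¹) := by
          rw [← ha, ← hb, hstar, ha, hb]; group
        rw [h1, hba]; group
      exact exists_isFreeUnitaryPair_of_unitary hk ψ hψ ha0 hb0 hc0 (by rw [hA]; exact hinv ha)
        (by rw [hB]; exact hinv hb) (by rw [hC]; exact hinv hsc)
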